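/- Let $\Gamma=\mathbb Z\rtimes\mathbb Z_2$ be the infinite dihedral group, where the nontrivial element of $\mathbb Z_2=\mathbb Z/2\mathbb Z$ acts on $\mathbb Z$ by multiplication by $-1$. Let $(n_i)_{i\ge1}$ be a strictly increasing sequence of natural numbers with $n_i\mid n_{i+1}$ for every $i$, and put $\Gamma_i=n_i\mathbb Z\rtimes\mathbb Z_2\le\Gamma$. Let $$X=\varprojlim\Gamma/\Gamma_i=\Big\{(x_i)\in\prod_i\Gamma/\Gamma_i : p_i(x_{i+1})=x_i\text{ for all }i\Big\},\qquad p_i(\gamma\Gamma_{i+1})=\gamma\Gamma_i,$$ with the topology inherited from the product of the finite discrete spaces $\Gamma/\Gamma_i$, and let $\Gamma$ act on $X$ by left multiplication in each coordinate. Let $C(X,\mathbb Z)$ be the $\Gamma$-module of continuous functions $X\to\mathbb Z$ ($\mathbb Z$ discrete), with $(\gamma f)(x)=f(\gamma^{-1}x)$, and let $H_*(\Gamma,C(X,\mathbb Z))$ denote group homology with coefficients in this module. Then there are isomorphisms of abelian groups $$H_0(\Gamma,C(X,\mathbb Z))\cong\Big\{\frac m{n_i}: m\in\mathbb Z,\ i\ge1\Big\}\subseteq\mathbb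 Q,$$ and, for every $k\ge1$, $$H_{2k}(\Gamma,C(X,\mathbb Z))=0,\qquad H_{2k-1}(\Gamma,C(X,\mathbb Z))\cong\begin{cases}\mathbb Z_2&\text{if } n_{i+1}/n_i\text{ is even for infinitely many } i,\\ (\mathbb Z_2)^2&\text{otherwise.}\end{cases}$$ -/

import Mathlib

/-- The action of `ℤ/2` on `ℤ` by multiplication by `-1` (both groups written multiplicatively). -/
def negAction : Multiplicative (ZMod 2) →* MulAut (Multiplicative ℤ) where
  toFun s := if s = 1 then 1 else MulEquiv.inv (Multiplicative ℤ)
  map_one' := if_pos rfl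
  map_mul' s t := by
    have key : ∀ s t : Multiplicative (ZMod 2),
        (s = 1 ∨ s = Multiplicative.ofAdd 1) ∧ (t = 1 ∨ t = Multiplicative.ofAdd 1) := by decide
    have h1 : (Multiplicative.ofAdd (1 : ZMod 2)) ≠ 1 := by decide
    have h2 : (Multiplicative.ofAdd (1 : ZMod 2)) * Multiplicative.ofAdd 1 = 1 := by decide
    obtain ⟨rfl | rfl, rfl | rfl⟩ := key s t
    · simp
    · simp [h1]
    · simp [h1]
    · rw [h2, if_pos rfl, if_neg h1]
      ext x
      simp

/-- The infinite dihedral group `ℤ ⋊ ℤ/2`. -/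
abbrev InfDihedral : Type := Multiplicative ℤ ⋊[negAction] Multiplicative (ZMod 2)

/-- The subgroup `nℤ ⋊ ℤ/2` of `ℤ ⋊ ℤ/2`. -/
def dihedralSubgroup (n : ℕ) : Subgroup InfDihedral where
  carrier := {g | (n : ℤ) ∣ Multiplicative.toAdd g.left}
  one_mem' := by simp
  mul_mem' := by
    intro a b ha hb
    simp only [Set.mem_ofPred_eq, SemidirectProduct.mul_left, toAdd_mul] at *
    refine dvd_add ha ?_
    simp only [negAction, MonoidHom.coe_mk, OneHom.coe_mk]
    split_ifs <;> simpa using hb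
  inv_mem' := by
    intro a ha
    simp only [Set.mem_ofPred_eq, SemidirectProduct.inv_left] at *
    simp only [negAction, MonoidHom.coe_mk, OneHom.coe_mk]
    split_ifs <;> simpa using ha

theorem dihedralSubgroup_le {m n : ℕ} (h : m ∣ n) : dihedralSubgroup n ≤ dihedralSubgroup m :=
  fun _ hg => (Int.natCast_dvd_natCast.mpr h).trans hg

section Odometer

variable {G : Type} [Group G] (H : ℕ → Subgroup G) (hH : ∀ i, H (i + 1) ≤ H i)

/-- The inverse limit of the coset spaces `G ⧸ H i` along the canonical surjections
`G ⧸ H (i + 1) → G ⧸ H i`. -/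
@[ext]
structure Odometer : Type where
  /-- The coordinates. -/
  coord : ∀ i, G ⧸ H i
  compat : ∀ i, Subgroup.quotientMapOfLE (hH i) (coord (i + 1)) = coord i

/-- The topology inherited from the product of the discrete spaces `G ⧸ H i`. -/
instance Odometer.instTopologicalSpace : TopologicalSpace (Odometer H hH) :=
  TopologicalSpace.induced Odometer.coord (@Pi.topologicalSpace ℕ (fun i => G ⧸ H i) (fun _ => ⊥))

/-- `G` acts on the odometer by left multiplication in every coordinate. -/
instance Odometer.instMulAction : MulAction G (Odometer H hH) where
  smul g x :=
    { coord := fun i => g • x.coord i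
      compat := fun i => by
        rw [← x.compat i]
        induction x.coord (i + 1) using QuotientGroup.induction_on
        rfl }
  one_smul x := Odometer.ext (funext fun i => one_smul G (x.coord i))
  mul_smul g h x := Odometer.ext (funext fun i => mul_smul g h (x.coord i))

instance Odometer.instContinuousConstSMul : ContinuousConstSMul G (Odometer H hH) where
  continuous_const_smul g := by
    let _ : ∀ i, TopologicalSpace (G ⧸ H i) := fun _ => ⊥
    have _ : ∀ i, DiscreteTopology (G ⧸ H i) := fun _ => ⟨rfl⟩
    refine continuous_induced_rng.mpr (continuous_pi fun i => ?_)
    exact (continuous_of_discreteTopology (f := fun y : G ⧸ H i => g • y)).comp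
      ((continuous_apply i).comp continuous_induced_dom)

end Odometer

/-- The representation of `G` on `C(X, ℤ)` given by `(g f)(x) = f (g⁻¹ x)`. -/
def continuousIntRepresentation (G X : Type) [Group G] [TopologicalSpace X] [MulAction G X]
    [ContinuousConstSMul G X] : Representation ℤ G C(X, ℤ) where
  toFun g :=
    { toFun := fun f => f.comp ⟨fun x => g⁻¹ • x, continuous_const_smul g⁻¹⟩
      map_add' := fun _ _ => rfl
      map_smul' := fun _ _ => rfl }
  map_one' := by
    ext f x
    simp
  map_mul' g h := by
    ext f x
    simp [mul_smul]

/-- The odometer `lim (ℤ ⋊ ℤ/2) ⧸ (nᵢℤ ⋊ ℤ/2)` of a sequence with `nᵢ ∣ nᵢ₊₁`. -/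
abbrev DihedralOdometer (n : ℕ → ℕ) (hdvd : ∀ i, n i ∣ n (i + 1)) : Type :=
  Odometer (fun i => dihedralSubgroup (n i)) (fun i => dihedralSubgroup_le (hdvd i))

/-- The group homology `H_k(ℤ ⋊ ℤ/2, C(X, ℤ))` of the odometer `X` of the sequence `n`. -/
noncomputable abbrev dihedralOdometerHomology (n : ℕ → ℕ) (hdvd : ∀ i, n i ∣ n (i + 1)) (k : ℕ) :
    ModuleCat ℤ :=
  groupHomology
    (Rep.of (continuousIntRepresentation InfDihedral (DihedralOdometer n hdvd))) k

/-- The subgroup `{m / nᵢ : m ∈ ℤ, i ∈ ℕ}` of `ℚ`. -/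
def fractionSubgroup (n : ℕ → ℕ) (hdvd : ∀ i, n i ∣ n (i + 1)) : AddSubgroup ℚ where
  carrier := {q | ∃ (m : ℤ) (i : ℕ), q = (m : ℚ) / (n i : ℚ)}
  zero_mem' := ⟨0, 0, by simp⟩
  neg_mem' := by
    rintro _ ⟨m, i, rfl⟩
    exact ⟨-m, i, by push_cast; ring⟩
  add_mem' := by
    have lift : ∀ (m : ℤ) (i j : ℕ), i ≤ j → n j ≠ 0 →
        ∃ m' : ℤ, (m : ℚ) / (n i : ℚ) = (m' : ℚ) / (n j : ℚ) := by
      intro m i j hij hj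
      obtain ⟨c, hc⟩ : n i ∣ n j := Nat.le_induction dvd_rfl
        (fun k _ h => h.trans (hdvd k)) j hij
      have hi : (n i : ℚ) ≠ 0 := by
        rintro h
        rw [Nat.cast_eq_zero] at h
        simp [h] at hc
        exact hj hc
      have hcq : (c : ℚ) ≠ 0 := by
        rintro h
        rw [Nat.cast_eq_zero] at h
        simp [h] at hc
        exact hj hc
      refine ⟨m * c, ?_⟩
      rw [hc]
      push_cast
      field_simp
    rintro _ _ ⟨a, i, rfl⟩ ⟨b, j, rfl⟩
    by_cases hi : n i = 0
    · exact ⟨b, j, by simp [hi]⟩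
    by_cases hj : n j = 0
    · exact ⟨a, i, by simp [hj]⟩
    rcases le_total i j with h | h
    · obtain ⟨a', ha⟩ := lift a i j h hj
      exact ⟨a' + b, j, by rw [ha]; push_cast; ring⟩
    · obtain ⟨b', hb⟩ := lift b j i h hi
      exact ⟨a + b', i, by rw [hb]; push_cast; ring⟩

/-! The infinite dihedral group G is the free product of the two groups of order two generated by
the reflections s and ts. The trivial module therefore has a free resolution glued from the periodic
resolutions of the two factors along one copy of k[G] in degree 0. Exactness rests on two facts
about the group algebra: for a reflection r and ε² = 1, the elements killed by right multiplication
by r - ε are the left multiples of r + ε (`exists_mul_reflectionSub_eq`), and the left ideals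
generated by s - 1 and ts - 1 meet only in zero (`mul_reflectionSub_eq_zero_of_add_eq_zero`).

Hence, with coefficients in A, positive even homology is the sum over r = s, ts of {a : ra = -a} /
(r - 1)A, and odd homology is the sum of A^r / (r + 1)A; degree 1 needs in addition that (s - 1)A
and (ts - 1)A meet only in zero.

For A = C(X, ℤ) this last condition follows from minimality of the translations. A function f with
rf = -f is (r - 1)(-f⁺), so the even groups vanish. An r-invariant function is of the form rg + g
exactly when it is even at the fixed points of r, so odd homology is (ℤ/2)^T with T the set of pairs
of a reflection and a fixed point of it (`nonempty_dihedralOdometerHomology_odd_addEquiv`). Such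
fixed points solve 2x = 0 or 2x = 1 in lim ℤ/n_j. If the power of 2 in n_j is unbounded, only x = 0
occurs; otherwise there are exactly two solutions in total.

In degree 0 the coinvariants are identified by integration against the invariant probability measure
(`nonempty_coinvariants_addEquiv`): every function is a sum of multiples of translates of one
indicator, whose integral is 1/n_j. -/

section

/-! ### Reflections and translations in the infinite dihedral group -/

open MonoidAlgebra

/-- The two reflections `s` and `ts` generating the infinite dihedral group, where `t` is the
generator of `ℤ` and `s` the nontrivial element of `ℤ/2`. -/
def dihedralReflection (i : Bool) : InfDihedral :=
  ⟨Multiplicative.ofAdd (if i then 1 else 0), Multiplicative.ofAdd 1⟩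

/-- The translation by `m` in the infinite dihedral group. -/
def dihedralTranslation (m : ℤ) : InfDihedral := ⟨Multiplicative.ofAdd m, 1⟩

theorem negAction_one (x : Multiplicative ℤ) :
    negAction (Multiplicative.ofAdd 1) x = x⁻¹ := by
  simp [negAction]

theorem multiplicative_zmod_two_eq (s : Multiplicative (ZMod 2)) :
    s = 1 ∨ s = Multiplicative.ofAdd 1 := by
  revert s; decide

theorem dihedralReflection_mul_self (i : Bool) :
    dihedralReflection i * dihedralReflection i = 1 := by
  ext
  · simp [dihedralReflection, negAction_one]
  · simp only [dihedralReflection, SemidirectProduct.mul_right, SemidirectProduct.one_right]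
    decide

theorem dihedralReflection_inv (i : Bool) : (dihedralReflection i)⁻¹ = dihedralReflection i :=
  inv_eq_of_mul_eq_one_left (dihedralReflection_mul_self i)

theorem dihedralReflection_true_mul_false :
    dihedralReflection true * dihedralReflection false = dihedralTranslation 1 := by
  ext
  · simp [dihedralReflection, dihedralTranslation]
  · simp only [dihedralReflection, dihedralTranslation, SemidirectProduct.mul_right]
    decide

theorem dihedralTranslation_mul (a b : ℤ) :
    dihedralTranslation a * dihedralTranslation b = dihedralTranslation (a + b) := by
  ext <;> simp [dihedralTranslation]

theorem dihedralTranslation_pow (a : ℤ) (m : ℕ) :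
    dihedralTranslation a ^ m = dihedralTranslation (m * a) := by
  induction m with
  | zero => simp [dihedralTranslation]
  | succ m ih => rw [pow_succ, ih, dihedralTranslation_mul]; congr 1; push_cast; ring

theorem dihedralTranslation_zpow (a m : ℤ) :
    dihedralTranslation a ^ m = dihedralTranslation (m * a) := by
  obtain ⟨m, rfl | rfl⟩ := m.eq_nat_or_neg
  · simp [dihedralTranslation_pow]
  · rw [zpow_neg, zpow_natCast, dihedralTranslation_pow, inv_eq_iff_mul_eq_one,
      dihedralTranslation_mul]
    simp [dihedralTranslation]

theorem dihedralTranslation_injective : Function.Injective dihedralTranslation := fun a b h => by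
  simpa [dihedralTranslation] using congrArg (fun g => Multiplicative.toAdd g.left) h

theorem eq_dihedralTranslation_or (g : InfDihedral) :
    ∃ m, g = dihedralTranslation m ∨ g = dihedralTranslation m * dihedralReflection false := by
  obtain ⟨l, r⟩ := g
  refine ⟨Multiplicative.toAdd l, ?_⟩
  rcases multiplicative_zmod_two_eq r with rfl | rfl
  · exact .inl rfl
  · right
    ext <;> simp [dihedralTranslation, dihedralReflection]

/-- The two reflections generate the infinite dihedral group. -/
theorem dihedralReflection_induction {S : Set InfDihedral} (h1 : 1 ∈ S)
    (hs : ∀ i, dihedralReflection i ∈ S) (hmul : ∀ g ∈ S, ∀ h ∈ S, g * h ∈ S)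
    (hinv : ∀ g ∈ S, g⁻¹ ∈ S) (g : InfDihedral) : g ∈ S := by
  let K : Subgroup InfDihedral :=
    { carrier := S, one_mem' := h1, mul_mem' := fun {a b} ha hb => hmul a ha b hb,
      inv_mem' := fun {a} ha => hinv a ha }
  have ht (m : ℤ) : dihedralTranslation m ∈ K := by
    have h := K.zpow_mem (K.mul_mem (hs true) (hs false)) m
    rwa [dihedralReflection_true_mul_false, dihedralTranslation_zpow, mul_one] at h
  obtain ⟨m, rfl | rfl⟩ := eq_dihedralTranslation_or g
  · exact ht m
  · exact K.mul_mem (ht m) (hs false)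

/-! ### Annihilators and the augmentation ideal in the group algebra -/

section GroupAlgebra

variable {k : Type} [CommRing k]

/-- The element `s - ε` of the group algebra, for a reflection `s`. -/
noncomputable def reflectionSub (i : Bool) (ε : k) : MonoidAlgebra k InfDihedral :=
  single (dihedralReflection i) 1 - single 1 ε

theorem reflectionSub_mul_reflectionSub (i : Bool) {ε : k} (hε : ε * ε = 1) :
    reflectionSub i (-ε) * reflectionSub i ε = 0 := by
  rw [reflectionSub, reflectionSub, single_neg, sub_neg_eq_add, add_mul, mul_sub, mul_sub]
  simp only [single_mul_single, dihedralReflection_mul_self, one_mul, mul_one, hε]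
  abel

/-- Right multiplication by a reflection s interchanges the elements supported on translations with
those supported on reflections. So x s = ε x determines the reflection half of x from its
translation half `R x`: x = R x (1 + ε s) = (ε R x)(s + ε). -/
theorem exists_mul_reflectionSub_eq {i : Bool} {ε : k} (hε : ε * ε = 1)
    {x : MonoidAlgebra k InfDihedral} (hx : x * reflectionSub i ε = 0) :
    ∃ y, y * reflectionSub i (-ε) = x := by
  classical
  let R : MonoidAlgebra k InfDihedral →+ MonoidAlgebra k InfDihedral :=
    { toFun := fun y => ofCoeff (y.coeff.filter fun g => g.right = 1)
      map_zero' := by rw [coeff_zero, Finsupp.filter_zero, ofCoeff_zero]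
      map_add' := fun y z => by simp [Finsupp.filter_add] }
  have hR (y : MonoidAlgebra k InfDihedral) : R (y * single (dihedralReflection i) 1) =
      (y - R y) * single (dihedralReflection i) 1 := by
    induction y using MonoidAlgebra.induction_linear with
    | zero => simp
    | add y z hy hz => rw [add_mul, map_add, hy, hz, map_add]; noncomm_ring
    | single g r =>
      have hs : (dihedralReflection i).right = Multiplicative.ofAdd 1 := rfl
      have h2 : Multiplicative.ofAdd (1 : ZMod 2) * Multiplicative.ofAdd (1 : ZMod 2) = 1 := by
        decide
      rcases multiplicative_zmod_two_eq g.right with h | h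
      · simp [R, single_mul_single, Finsupp.filter_single_of_pos, h,
          Finsupp.filter_single_of_neg, hs]
      · simp [R, single_mul_single, Finsupp.filter_single_of_pos, h,
          Finsupp.filter_single_of_neg, hs, h2]
  have hRs (y : MonoidAlgebra k InfDihedral) : R (y * single 1 ε) = R y * single 1 ε := by
    induction y using MonoidAlgebra.induction_linear with
    | zero => simp
    | add y z hy hz => rw [add_mul, map_add, hy, hz, map_add, add_mul]
    | single g r =>
      rw [single_mul_single, mul_one]
      by_cases h : g.right = 1
      · simp [-Finsupp.single_mul, R, single_mul_single, Finsupp.filter_single_of_pos, h]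
      · simp [-Finsupp.single_mul, R, Finsupp.filter_single_of_neg, h]
  rw [reflectionSub, mul_sub, sub_eq_zero] at hx
  have h1 := congrArg R hx
  rw [hR, hRs] at h1
  have h2 := congrArg (· * single (dihedralReflection i) (1 : k)) h1
  simp only [mul_assoc, single_mul_single, dihedralReflection_mul_self, mul_one, one_mul] at h2
  rw [← one_def, mul_one] at h2
  refine ⟨R x * single 1 ε, ?_⟩
  rw [reflectionSub, mul_sub, mul_assoc, mul_assoc, single_mul_single, single_mul_single, one_mul,
    mul_one, mul_one, mul_neg, hε, ← h2, single_neg, ← one_def]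
  noncomm_ring

/-- The coefficients are constant along the infinite sequences g, gt, gt², …, while the support is
finite. -/
theorem eq_zero_of_mul_dihedralTranslation {x : MonoidAlgebra k InfDihedral}
    (hx : x * single (dihedralTranslation 1) 1 = x) : x = 0 := by
  have h (m : ℕ) (g : InfDihedral) : x.coeff (g * dihedralTranslation m) = x.coeff g := by
    induction m with
    | zero => rw [Nat.cast_zero, ← mul_one g, mul_assoc]; rfl
    | succ m ih =>
      rw [← ih]
      conv_lhs => rw [← hx]
      rw [coeff_mul_single_apply, mul_one]
      congr 1
      rw [mul_inv_eq_iff_eq_mul, mul_assoc, dihedralTranslation_mul, Nat.cast_succ]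
  ext g
  by_contra hg
  refine Set.infinite_of_injective_forall_mem (f := fun m : ℕ => g * dihedralTranslation m)
    (fun a b hab => ?_) (s := x.coeff.support) (fun m => ?_) x.coeff.support.finite_toSet
  · exact_mod_cast dihedralTranslation_injective (mul_left_cancel hab)
  · simpa [h] using hg

/-- A left multiple of r - 1 is negated by right multiplication by the reflection r. When the sum
vanishes, each summand is negated by both reflections, hence fixed by their product, a translation
of infinite order, hence zero. -/
theorem mul_reflectionSub_eq_zero_of_add_eq_zero {x : Bool → MonoidAlgebra k InfDihedral}
    (hx : x false * reflectionSub false 1 + x true * reflectionSub true 1 = 0) (i : Bool) :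
    x i * reflectionSub i 1 = 0 := by
  have hmul (i : Bool) (y : MonoidAlgebra k InfDihedral) :
      y * reflectionSub i 1 * single (dihedralReflection i) 1 = - (y * reflectionSub i 1) := by
    rw [mul_assoc, ← mul_neg]
    congr 1
    simp [reflectionSub, sub_mul, single_mul_single, dihedralReflection_mul_self]
  have key : x true * reflectionSub true 1 = 0 := by
    apply eq_zero_of_mul_dihedralTranslation
    rw [← dihedralReflection_true_mul_false, ← one_mul (1 : k), ← single_mul_single, ← mul_assoc,
      one_mul, hmul, eq_neg_of_add_eq_zero_right hx, neg_neg, hmul]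
  cases i
  · simpa [key] using hx
  · exact key

/-- The augmentation ideal is generated by the r - 1 with r in a generating set, by the identity gh
- 1 = g(h - 1) + (g - 1). -/
theorem exists_add_mul_reflectionSub {x : MonoidAlgebra k InfDihedral}
    (hx : x.coeff.sum (fun _ r => r) = 0) :
    ∃ y : Bool → MonoidAlgebra k InfDihedral,
      y false * reflectionSub false 1 + y true * reflectionSub true 1 = x := by
  let I : Submodule (MonoidAlgebra k InfDihedral) (MonoidAlgebra k InfDihedral) :=
    Submodule.span _ {reflectionSub false 1, reflectionSub true 1}
  have hgen (g : InfDihedral) : single g (1 : k) - 1 ∈ I := by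
    refine dihedralReflection_induction (S := {g | single g (1 : k) - 1 ∈ I}) ?_ ?_ ?_ ?_ g
    · simp [← one_def]
    · intro i
      apply Submodule.subset_span
      cases i <;> simp [reflectionSub, ← one_def]
    · intro g hg h hh
      have := I.add_mem (I.smul_mem (single g 1) hh) hg
      simpa [mul_sub, single_mul_single] using this
    · intro g hg
      have := I.neg_mem (I.smul_mem (single g⁻¹ 1) hg)
      simpa [mul_sub, single_mul_single, ← one_def] using this
  have hmem : x ∈ I := by
    -- The coefficients sum to zero, so their sum times the unit may be subtracted from x.
    have h : x = x.coeff.sum fun g r => single 1 r * (single g 1 - 1) := by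
      conv_lhs => rw [← sub_zero x, ← single_zero (1 : InfDihedral), ← hx]
      have : single (1 : InfDihedral) (x.coeff.sum fun _ r => r) =
          x.coeff.sum fun _ r => single (1 : InfDihedral) r :=
        map_finsuppSum (singleAddHom (R := k) (1 : InfDihedral)) _ _
      rw [this]
      nth_rw 1 [← sum_coeff_single x]
      rw [Finsupp.sum, Finsupp.sum, ← Finset.sum_sub_distrib]
      exact Finset.sum_congr rfl fun g _ => by simp [mul_sub, single_mul_single]
    rw [h]
    exact I.sum_mem fun g _ => I.smul_mem _ (hgen g)
  obtain ⟨a, b, h⟩ := Submodule.mem_span_pair.mp hmem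
  exact ⟨fun i => cond i b a, h⟩

end GroupAlgebra

end

/-! ### The free resolution of the trivial representation -/

section

open CategoryTheory Rep Finsupp

section Boundary

variable (k : Type) [CommRing k] {ι ι' : Type} (l : ι' → Bool) (f : ι' → ι) (ε : k)

/-- The morphism of free representations that maps `single i x` to
`single (f i) (x * (s (l i) - ε))`. -/
noncomputable def reflectionBoundary : free k InfDihedral ι' ⟶ free k InfDihedral ι :=
  freeLift k InfDihedral _ fun i => single (f i) (reflectionSub (l i) ε)

theorem reflectionBoundary_single (i : ι') (x : MonoidAlgebra k InfDihedral) :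
    DFunLike.coe (F := (Representation.free k InfDihedral ι').IntertwiningMap
      (Representation.free k InfDihedral ι)) (reflectionBoundary k l f ε).hom (single i x) =
      single (f i) (x * reflectionSub (l i) ε) := by
  induction x using MonoidAlgebra.induction_linear with
  | zero => simp
  | add x y hx hy => rw [single_add, map_add, hx, hy, add_mul, single_add]
  | single g r =>
    rw [reflectionBoundary, Rep.hom_ofHom, Representation.freeLift_single_single]
    simp [-Finsupp.single_mul, reflectionSub, mul_sub, MonoidAlgebra.single_mul_single, smul_sub,
      mul_comm]

theorem reflectionBoundary_apply (x : ι' →₀ MonoidAlgebra k InfDihedral) :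
    DFunLike.coe (F := (Representation.free k InfDihedral ι').IntertwiningMap
      (Representation.free k InfDihedral ι)) (reflectionBoundary k l f ε).hom x =
      x.sum fun i y => single (f i) (y * reflectionSub (l i) ε) := by
  conv_lhs => rw [← sum_single x, map_finsuppSum]
  simp only [reflectionBoundary_single]

/-- The morphism of representations that maps `single i x` to the sum of the coefficients of
`x`. -/
noncomputable def freeAugmentation : free k InfDihedral ι ⟶ trivial k InfDihedral k :=
  freeLift k InfDihedral (trivial k InfDihedral k) fun _ => (1 : k)

theorem freeAugmentation_single (i : ι) (x : MonoidAlgebra k InfDihedral) :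
    DFunLike.coe (F := (Representation.free k InfDihedral ι).IntertwiningMap
      (Representation.trivial k InfDihedral k)) (freeAugmentation k).hom (single i x) =
      x.coeff.sum fun _ r => r := by
  induction x using MonoidAlgebra.induction_linear with
  | zero => simp
  | add x y hx hy =>
    rw [single_add, map_add, hx, hy, MonoidAlgebra.coeff_add,
      sum_add_index' (fun _ => rfl) (fun _ _ _ => rfl)]
  | single g r =>
    rw [freeAugmentation, Rep.hom_ofHom, Representation.freeLift_single_single]
    simp

theorem reflectionBoundary_comp {ι'' : Type} (l' : ι'' → Bool) (f' : ι'' → ι')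
    (h : ∀ i, l (f' i) = l' i) (hε : ε * ε = 1) :
    reflectionBoundary k l' f' (-ε) ≫ reflectionBoundary k l f ε = 0 := by
  refine free_ext _ _ _ _ _ fun i => ?_
  rw [Rep.hom_comp, Representation.IntertwiningMap.comp_apply, reflectionBoundary_single,
    reflectionBoundary_single, ← MonoidAlgebra.one_def, one_mul, h,
    reflectionSub_mul_reflectionSub _ hε]
  exact single_zero _

theorem reflectionBoundary_comp_freeAugmentation :
    reflectionBoundary k l f 1 ≫ freeAugmentation k = 0 := by
  refine free_ext _ _ _ _ _ fun i => ?_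
  rw [Rep.hom_comp, Representation.IntertwiningMap.comp_apply, reflectionBoundary_single,
    freeAugmentation_single, ← MonoidAlgebra.one_def, one_mul, reflectionSub,
    MonoidAlgebra.coeff_sub, sum_sub_index (fun _ _ _ => rfl)]
  simp

theorem exists_reflectionBoundary_eq_of_freeAugmentation_eq_zero
    (x : Unit →₀ MonoidAlgebra k InfDihedral)
    (hx : DFunLike.coe (F := (Representation.free k InfDihedral Unit).IntertwiningMap
      (Representation.trivial k InfDihedral k)) (freeAugmentation k).hom x = 0) :
    ∃ y, (reflectionBoundary k id (fun _ : Bool => ()) 1).hom y = x := by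
  have h : x = single () (x ()) := by ext; simp
  rw [h] at hx ⊢
  rw [freeAugmentation_single] at hx
  obtain ⟨y, hy⟩ := exists_add_mul_reflectionSub hx
  refine ⟨(equivFunOnFinite.symm y : Bool →₀ _), (reflectionBoundary_apply k _ _ _ _).trans ?_⟩
  rw [← hy, sum_fintype _ _ (fun _ => by simp)]
  simp [-Finsupp.single_mul, single_add, add_comm]

theorem exists_reflectionBoundary_eq (hε : ε * ε = 1)
    (x : Bool →₀ MonoidAlgebra k InfDihedral) (h : ∀ i, x i * reflectionSub i ε = 0) :
    ∃ y, (reflectionBoundary k id (id : Bool → Bool) (-ε)).hom y = x := by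
  choose y hy using fun i => exists_mul_reflectionSub_eq hε (h i)
  refine ⟨(equivFunOnFinite.symm y : Bool →₀ _), (reflectionBoundary_apply k _ _ _ _).trans ?_⟩
  rw [sum_fintype _ _ (fun _ => by simp)]
  simp only [equivFunOnFinite_symm_apply_apply, id, hy]
  exact Finsupp.univ_sum_single x

theorem exists_reflectionBoundary_eq_of_eq_zero (hε : ε * ε = 1)
    (x : Bool →₀ MonoidAlgebra k InfDihedral)
    (hx : DFunLike.coe (F := (Representation.free k InfDihedral Bool).IntertwiningMap
      (Representation.free k InfDihedral Bool))
      (reflectionBoundary k id (id : Bool → Bool) ε).hom x = 0) :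
    ∃ y, (reflectionBoundary k id (id : Bool → Bool) (-ε)).hom y = x := by
  refine exists_reflectionBoundary_eq k ε hε x fun i => ?_
  rw [reflectionBoundary_apply, sum_fintype _ _ (fun _ => by simp)] at hx
  simpa using DFunLike.congr_fun ((Finsupp.univ_sum_single
    (equivFunOnFinite.symm fun i => x i * reflectionSub i ε)).symm.trans hx) i

/-- In degree one both components land in the same copy of k[G]. Since the two left ideals meet only
in zero, each component vanishes separately, and exactness reduces to the diagonal case. -/
theorem exists_reflectionBoundary_eq_of_unit_eq_zero
    (x : Bool →₀ MonoidAlgebra k InfDihedral)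
    (hx : DFunLike.coe (F := (Representation.free k InfDihedral Bool).IntertwiningMap
      (Representation.free k InfDihedral Unit))
      (reflectionBoundary k id (fun _ : Bool => ()) 1).hom x = 0) :
    ∃ y, (reflectionBoundary k id (id : Bool → Bool) (-1)).hom y = x := by
  refine exists_reflectionBoundary_eq k 1 (one_mul 1) x fun i =>
    mul_reflectionSub_eq_zero_of_add_eq_zero (x := x) ?_ i
  rw [reflectionBoundary_apply, sum_fintype _ _ (fun _ => by simp)] at hx
  simpa [-Finsupp.single_mul, add_comm, ← single_add] using hx

end Boundary

/-- The index type of a basis of the `n`-th term of the resolution: one generator in degree `0`,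
and one for each of the two reflections in positive degrees. -/
def ReflectionIndex : ℕ → Type
  | 0 => Unit
  | _ + 1 => Bool

/-- The reflection of a generator. -/
def reflectionLabel : (n : ℕ) → ReflectionIndex (n + 1) → Bool := fun _ => id

/-- The generator that occurs in the boundary of a generator. -/
def reflectionFace : (n : ℕ) → ReflectionIndex (n + 1) → ReflectionIndex n
  | 0 => fun _ => ()
  | _ + 1 => id

namespace dihedralResolution

variable (k : Type) [CommRing k]

/-- The complex `⋯ ⟶ k[G]² ⟶ k[G]² ⟶ k[G]` with differentials
`(x, y) ↦ x (s - 1) + y (ts - 1)`, `(x, y) ↦ (x (s + 1), y (ts + 1))`,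
`(x, y) ↦ (x (s - 1), y (ts - 1))`, `⋯`. -/
noncomputable abbrev complex : ChainComplex (Rep k InfDihedral) ℕ :=
  ChainComplex.of (fun n => free k InfDihedral (ReflectionIndex n))
    (fun n => reflectionBoundary k (reflectionLabel n) (reflectionFace n) ((-1) ^ n))
    fun n => by
      rw [pow_succ, mul_neg_one]
      exact reflectionBoundary_comp k _ _ _ _ _ (fun _ => rfl) (by rw [← mul_pow]; simp)

theorem complex_d (n : ℕ) : (complex k).d (n + 1) n =
    reflectionBoundary k (reflectionLabel n) (reflectionFace n) ((-1) ^ n) :=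
  ChainComplex.of_d (fun n => free k InfDihedral (ReflectionIndex n))
    (fun n => reflectionBoundary k (reflectionLabel n) (reflectionFace n) ((-1) ^ n)) n

theorem exact_of_forall_exists {X Y Z : Rep k InfDihedral} {f : X ⟶ Y} {g : Y ⟶ Z}
    (w : f ≫ g = 0) (h : ∀ y, g.hom y = 0 → ∃ x, f.hom x = y) :
    (ShortComplex.mk f g w).Exact := by
  apply (forget₂ _ (ModuleCat k)).reflects_exact_of_faithful
  rw [ShortComplex.moduleCat_exact_iff]
  exact h

/-- The augmentation as a morphism of complexes. -/
noncomputable def π : complex k ⟶ (ChainComplex.single₀ _).obj (trivial k InfDihedral k) :=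
  ((complex k).toSingle₀Equiv _).symm ⟨freeAugmentation k, by
    rw [complex_d, pow_zero]
    exact reflectionBoundary_comp_freeAugmentation k _ _⟩

theorem exactAt_succ (m : ℕ) : (complex k).ExactAt (m + 1) := by
  -- The differentials become variables, so that the explicit formulas of `complex_d` can be
  -- substituted for them.
  have key (f : free k InfDihedral (ReflectionIndex (m + 2)) ⟶
        free k InfDihedral (ReflectionIndex (m + 1)))
      (g : free k InfDihedral (ReflectionIndex (m + 1)) ⟶
        free k InfDihedral (ReflectionIndex m))
      (hf : (complex k).d (m + 2) (m + 1) = f) (hg : (complex k).d (m + 1) m = g)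
      (h : ∀ y, g.hom y = 0 → ∃ x, f.hom x = y) : (complex k).ExactAt (m + 1) := by
    rw [HomologicalComplex.exactAt_iff' _ (m + 2) (m + 1) m (by simp) (by simp)]
    subst hf hg
    exact exact_of_forall_exists k _ h
  refine key _ _ (complex_d k (m + 1)) (complex_d k m) fun y hy => ?_
  cases m with
  | zero =>
    rw [pow_zero] at hy
    rw [pow_succ, pow_zero, one_mul]
    exact exists_reflectionBoundary_eq_of_unit_eq_zero k y hy
  | succ m =>
    rw [pow_succ _ (m + 1), mul_neg_one]
    exact exists_reflectionBoundary_eq_of_eq_zero k _ (by rw [← mul_pow]; simp) y hy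

instance : QuasiIso (π k) where
  quasiIsoAt m := by
    cases m with
    | zero =>
      -- In degree 0 the claim becomes exactness at k[G] together with surjectivity of the
      -- augmentation.
      rw [ChainComplex.quasiIsoAt₀_iff, ShortComplex.quasiIso_iff_of_zeros' _ rfl rfl rfl]
      have hπ : (π k).f 0 = freeAugmentation k :=
        ChainComplex.toSingle₀Equiv_symm_apply_f_zero _ _
      constructor
      · have key (f : free k InfDihedral (ReflectionIndex 1) ⟶
              free k InfDihedral (ReflectionIndex 0))
            (g : free k InfDihedral (ReflectionIndex 0) ⟶ trivial k InfDihedral k)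
            (hf : (complex k).d 1 0 = f) (hg : (π k).f 0 = g) (w : f ≫ g = 0)
            (h : ∀ y, g.hom y = 0 → ∃ x, f.hom x = y) :
            (ShortComplex.mk ((complex k).d 1 0) ((π k).f 0) (by rw [hf, hg]; exact w)).Exact := by
          subst hf hg
          exact exact_of_forall_exists k _ h
        refine key _ _ (complex_d k 0) hπ ?_ fun y hy => ?_
        · rw [pow_zero]
          exact reflectionBoundary_comp_freeAugmentation k _ _
        · rw [pow_zero]
          exact exists_reflectionBoundary_eq_of_freeAugmentation_eq_zero k y hy
      · change Epi ((π k).f 0)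
        rw [hπ]
        refine (Rep.epi_iff_surjective _).2 fun x : k => ⟨single () (MonoidAlgebra.single 1 x), ?_⟩
        refine (freeAugmentation_single k _ _).trans ?_
        rw [MonoidAlgebra.coeff_single, sum_single_index rfl]
    | succ m =>
      rw [quasiIsoAt_iff_exactAt' (hL := ChainComplex.exactAt_succ_single_obj ..)]
      exact exactAt_succ k m

/-- The projective resolution of the trivial representation of the infinite dihedral group. -/
noncomputable def _root_.dihedralResolution : ProjectiveResolution (trivial k InfDihedral k) where
  complex := complex k
  projective n := inferInstanceAs (Projective (free k InfDihedral (ReflectionIndex n)))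
  π := π k

end dihedralResolution

end

/-! ### Homology of the infinite dihedral group with arbitrary coefficients -/

section

open CategoryTheory Rep Finsupp

/-- The homology of a complex of modules is `T` if there is a surjection from the cycles onto `T`
whose kernel consists of the boundaries. -/
theorem nonempty_homology_addEquiv {k : Type} [CommRing k] (C : ChainComplex (ModuleCat k) ℕ)
    (n : ℕ) {T : Type} [AddCommGroup T] [Module k T]
    (φ : LinearMap.ker (C.d (n + 1) n).hom →ₗ[k] T) (hφ : Function.Surjective φ)
    (hker : ∀ x, φ x = 0 ↔ ∃ y, (C.d (n + 2) (n + 1)).hom y = x.1) :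
    Nonempty (C.homology (n + 1) ≃+ T) := by
  have e1 := (ShortComplex.homologyMapIso (C.isoSc' (n + 2) (n + 1) n (by simp) (by simp)) ≪≫
    ShortComplex.moduleCatHomologyIso _).toLinearEquiv
  refine ⟨(e1.trans ((Submodule.quotEquivOfEq _ (LinearMap.ker φ) ?_).trans
    (φ.quotKerEquivOfSurjective hφ))).toAddEquiv⟩
  ext x
  refine Iff.trans ?_ (hker x).symm
  exact exists_congr fun y => Subtype.ext_iff

section

variable {k : Type} [CommRing k] (A : Rep.{0} k InfDihedral)

/-- The linear map `(ι' →₀ A) → (ι →₀ A)` that maps `single i a` to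
`single (f i) (s (l i) a - ε a)`. -/
noncomputable def reflectionChainsD {ι ι' : Type} (l : ι' → Bool) (f : ι' → ι) (ε : k) :
    (ι' →₀ A) →ₗ[k] (ι →₀ A) :=
  lsum k fun i => lsingle (f i) ∘ₗ (A.ρ (dihedralReflection (l i)) - ε • LinearMap.id)

theorem reflectionChainsD_apply {ι ι' : Type} [Fintype ι'] (l : ι' → Bool) (f : ι' → ι) (ε : k)
    (x : ι' →₀ A) : reflectionChainsD A l f ε x =
      ∑ i, single (f i) (A.ρ (dihedralReflection (l i)) (x i) - ε • x i) := by
  rw [reflectionChainsD, lsum_apply, sum_fintype _ _ (fun _ => by simp)]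
  rfl

open ModuleCat.MonoidalCategory in
open scoped Classical in
-- The identification of the coinvariants of A ⊗ k[G]^ι with A^ι sends the class of a ⊗ g to g⁻¹a.
-- Right multiplication by a reflection s thus becomes the action of s⁻¹ = s on A.
theorem coinvariantsTensor_map_reflectionBoundary {ι ι' : Type} (l : ι' → Bool) (f : ι' → ι)
    (ε : k) :
    ((coinvariantsTensor k InfDihedral).obj A).map (reflectionBoundary k l f ε) ≫
      (coinvariantsTensorFreeLEquiv A ι).toModuleIso.hom =
    (coinvariantsTensorFreeLEquiv A ι').toModuleIso.hom ≫
      ModuleCat.ofHom (reflectionChainsD A l f ε) := by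
  refine coinvariantsTensor_hom_ext (LinearMap.ext fun a => lhom_ext' fun i =>
    MonoidAlgebra.lhom_ext' fun g => LinearMap.ext_ring ?_)
  have h1 : DFunLike.coe (F := (Representation.free k InfDihedral ι').IntertwiningMap
      (Representation.free k InfDihedral ι)) (reflectionBoundary k l f ε).hom
      (single i (.single g 1)) =
      single (f i) (.single (g * dihedralReflection (l i)) 1) - single (f i) (.single g ε) := by
    rw [reflectionBoundary_single, reflectionSub, mul_sub, MonoidAlgebra.single_mul_single,
      MonoidAlgebra.single_mul_single, mul_one, mul_one, one_mul, single_sub]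
  change coinvariantsTensorFreeToFinsupp A ι (Representation.Coinvariants.mk _ (a ⊗ₜ[k]
      DFunLike.coe (F := (Representation.free k InfDihedral ι').IntertwiningMap
      (Representation.free k InfDihedral ι)) (reflectionBoundary k l f ε).hom
      (single i (.single g 1)))) = reflectionChainsD A l f ε
      (coinvariantsTensorFreeToFinsupp A ι' (Representation.Coinvariants.mk _
        (a ⊗ₜ[k] single i (.single g 1))))
  rw [h1, TensorProduct.tmul_sub, map_sub, map_sub]
  refine Eq.trans (congrArg₂ _ (coinvariantsTensorFreeToFinsupp_mk_tmul_single A _ _ _ _)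
    (coinvariantsTensorFreeToFinsupp_mk_tmul_single A _ _ _ _)) ?_
  refine Eq.trans ?_ (congrArg _ (coinvariantsTensorFreeToFinsupp_mk_tmul_single A _ _ _ _).symm)
  simp [reflectionChainsD, dihedralReflection_inv]

theorem reflectionChainsD_comp {ι ι' ι'' : Type} (l : ι' → Bool) (f : ι' → ι) (ε : k)
    (l' : ι'' → Bool) (f' : ι'' → ι') (h : ∀ i, l (f' i) = l' i) (hε : ε * ε = 1) :
    reflectionChainsD A l f ε ∘ₗ reflectionChainsD A l' f' (-ε) = 0 := by
  refine lhom_ext fun i a => ?_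
  have h1 : A.ρ (dihedralReflection (l' i)) (A.ρ (dihedralReflection (l' i)) a) = a := by
    rw [← Module.End.mul_apply, ← map_mul, dihedralReflection_mul_self, map_one,
      Module.End.one_apply]
  have h2 : reflectionChainsD A l' f' (-ε) (single i a) =
      single (f' i) (A.ρ (dihedralReflection (l' i)) a - (-ε) • a) := by
    rw [reflectionChainsD, lsum_single]; rfl
  rw [LinearMap.comp_apply, h2, reflectionChainsD, lsum_single, h]
  change single _ (A.ρ _ (A.ρ _ a - (-ε) • a) - ε • (A.ρ _ a - (-ε) • a)) = _
  rw [map_sub, map_smul, h1, smul_sub, smul_smul, mul_neg, hε,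
    show a - -ε • A.ρ (dihedralReflection (l' i)) a -
      (ε • A.ρ (dihedralReflection (l' i)) a - -(1 : k) • a) = 0 by module, single_zero]
  rfl

/-- The complex `⋯ ⟶ A² ⟶ A² ⟶ A` with differentials `(a, b) ↦ (s - 1) a + (ts - 1) b`,
`(a, b) ↦ ((s + 1) a, (ts + 1) b)`, `(a, b) ↦ ((s - 1) a, (ts - 1) b)`, `⋯`, whose homology is the
homology of the infinite dihedral group with coefficients in `A`. -/
noncomputable abbrev reflectionChains : ChainComplex (ModuleCat k) ℕ :=
  ChainComplex.of (fun n => ModuleCat.of k (ReflectionIndex n →₀ A))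
    (fun n => ModuleCat.ofHom
      (reflectionChainsD A (reflectionLabel n) (reflectionFace n) ((-1) ^ n)))
    fun n => by
      rw [← ModuleCat.ofHom_comp, pow_succ, mul_neg_one]
      exact congrArg ModuleCat.ofHom
        (reflectionChainsD_comp A _ _ _ _ _ (fun _ => rfl) (by rw [← mul_pow]; simp))

theorem reflectionChains_d (n : ℕ) : (reflectionChains A).d (n + 1) n = ModuleCat.ofHom
    (reflectionChainsD A (reflectionLabel n) (reflectionFace n) ((-1) ^ n)) :=
  ChainComplex.of_d (fun n => ModuleCat.of k (ReflectionIndex n →₀ A))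
    (fun n => ModuleCat.ofHom
      (reflectionChainsD A (reflectionLabel n) (reflectionFace n) ((-1) ^ n))) n

open scoped Classical in
/-- The complex `(A ⊗ P)_G` of the resolution `P` is isomorphic to `reflectionChains A`. -/
noncomputable def coinvariantsTensorDihedralResolutionIso :
    (dihedralResolution k).complex.coinvariantsTensorObj A ≅ reflectionChains A :=
  HomologicalComplex.Hom.isoOfComponents
    (fun n => (coinvariantsTensorFreeLEquiv A (ReflectionIndex n)).toModuleIso) fun i j h => by
      subst h
      rw [reflectionChains_d]
      refine (coinvariantsTensor_map_reflectionBoundary A _ _ _).symm.trans ?_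
      congr 1
      change _ = ((coinvariantsTensor k InfDihedral).obj A).map
        ((dihedralResolution.complex k).d (j + 1) j)
      rw [dihedralResolution.complex_d]

/-- The homology of the infinite dihedral group is computed by `reflectionChains`. -/
noncomputable def groupHomologyIsoReflectionChains (n : ℕ) :
    groupHomology A n ≅ (reflectionChains A).homology n :=
  open scoped Classical in
  groupHomologyIso A n (dihedralResolution k) ≪≫
    HomologicalComplex.homologyMapIso (coinvariantsTensorDihedralResolutionIso A) n

theorem nonempty_groupHomology_addEquiv (n : ℕ) {T : Type} [AddCommGroup T] [Module k T]
    (φ : LinearMap.ker (reflectionChainsD A (reflectionLabel n) (reflectionFace n) ((-1) ^ n)) →ₗ[k]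
      T)
    (hφ : Function.Surjective φ)
    (hker : ∀ x, φ x = 0 ↔ ∃ y, reflectionChainsD A (reflectionLabel (n + 1))
      (reflectionFace (n + 1)) ((-1) ^ (n + 1)) y = x.1) :
    Nonempty (groupHomology A (n + 1) ≃+ T) := by
  have key (f : (ReflectionIndex (n + 2) →₀ A) →ₗ[k] (ReflectionIndex (n + 1) →₀ A))
      (g : (ReflectionIndex (n + 1) →₀ A) →ₗ[k] (ReflectionIndex n →₀ A))
      (hf : f = ((reflectionChains A).d (n + 2) (n + 1)).hom)
      (hg : g = ((reflectionChains A).d (n + 1) n).hom)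
      (φ : LinearMap.ker g →ₗ[k] T) (hφ : Function.Surjective φ)
      (hker : ∀ x, φ x = 0 ↔ ∃ y, f y = x.1) :
      Nonempty ((reflectionChains A).homology (n + 1) ≃+ T) := by
    subst hf hg
    exact nonempty_homology_addEquiv _ n φ hφ hker
  obtain ⟨e⟩ := key _ _ (by rw [reflectionChains_d]; rfl) (by rw [reflectionChains_d]; rfl) φ hφ
    hker
  exact ⟨(groupHomologyIsoReflectionChains A (n + 1)).toLinearEquiv.toAddEquiv.trans e⟩

theorem reflectionChainsD_id_eq_iff (ε : k) (x y : Bool →₀ A) :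
    reflectionChainsD A id (id : Bool → Bool) ε x = y ↔
      ∀ i, A.ρ (dihedralReflection i) (x i) - ε • x i = y i := by
  rw [reflectionChainsD_apply]
  have h : ∑ i, single (id i) (A.ρ (dihedralReflection (id i)) (x i) - ε • x i) =
      equivFunOnFinite.symm fun i => A.ρ (dihedralReflection i) (x i) - ε • x i :=
    Finsupp.univ_sum_single
      (equivFunOnFinite.symm fun i => A.ρ (dihedralReflection i) (x i) - ε • x i)
  rw [h, DFunLike.ext_iff]
  rfl

theorem reflectionChainsD_unit_eq_zero_iff (x : Bool →₀ A) :
    reflectionChainsD A id (fun _ : Bool => ()) (1 : k) x = 0 ↔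
      (A.ρ (dihedralReflection false) (x false) - x false) +
        (A.ρ (dihedralReflection true) (x true) - x true) = 0 := by
  rw [reflectionChainsD_apply, Fintype.sum_bool, ← single_add, single_eq_zero, add_comm]
  simp only [one_smul, id]

/-- The even homology vanishes if every `a` with `s a = -a`, for a reflection `s`, is of the form
`s b - b`. -/
theorem subsingleton_groupHomology_even {m : ℕ} (hm : 1 ≤ m)
    (h : ∀ i (a : A), A.ρ (dihedralReflection i) a = -a →
      ∃ b, A.ρ (dihedralReflection i) b - b = a) :
    Subsingleton (groupHomology A (2 * m)) := by
  obtain ⟨m, rfl⟩ := Nat.exists_eq_add_of_le' hm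
  suffices Nonempty (groupHomology A (2 * m + 1 + 1) ≃+ PUnit) from this.some.toEquiv.subsingleton
  refine nonempty_groupHomology_addEquiv A (2 * m + 1) (T := PUnit) 0
    (fun _ => ⟨0, rfl⟩) fun ⟨x, hx⟩ => ⟨fun _ => ?_, fun _ => rfl⟩
  · have hx' := (reflectionChainsD_id_eq_iff A _ x 0).1 (LinearMap.mem_ker.1 hx)
    rw [pow_succ, pow_mul, neg_one_sq, one_pow, one_mul] at hx'
    choose y hy using fun i => h i (x i)
      (eq_neg_of_add_eq_zero_left (by simpa using! hx' i))
    refine ⟨(equivFunOnFinite.symm y : Bool →₀ A), (reflectionChainsD_id_eq_iff A _ _ x).2 ?_⟩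
    intro i
    rw [show 2 * m + 1 + 1 = 2 * (m + 1) by ring, pow_mul, neg_one_sq, one_pow, one_smul]
    exact hy i

/-- The odd homology in terms of the invariants of the two reflections. -/
theorem nonempty_groupHomology_odd_addEquiv {m : ℕ} (hm : 1 ≤ m)
    (h : ∀ a b : A, (A.ρ (dihedralReflection false) a - a) +
      (A.ρ (dihedralReflection true) b - b) = 0 → A.ρ (dihedralReflection false) a = a)
    {T : Type} [AddCommGroup T] [Module k T] (ψ : (Bool → A) →ₗ[k] T)
    (hψ : ∀ t, ∃ x : Bool → A, (∀ i, A.ρ (dihedralReflection i) (x i) = x i) ∧ ψ x = t)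
    (hker : ∀ x : Bool → A, (∀ i, A.ρ (dihedralReflection i) (x i) = x i) →
      (ψ x = 0 ↔ ∀ i, ∃ y, A.ρ (dihedralReflection i) y + y = x i)) :
    Nonempty (groupHomology A (2 * m - 1) ≃+ T) := by
  obtain ⟨m, rfl⟩ := Nat.exists_eq_add_of_le' hm
  rw [show 2 * (m + 1) - 1 = 2 * m + 1 by omega]
  have hcyc (x : Bool →₀ A) : reflectionChainsD A (reflectionLabel (2 * m))
      (reflectionFace (2 * m)) ((-1) ^ (2 * m)) x = 0 ↔
      ∀ i, A.ρ (dihedralReflection i) (x i) = x i := by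
    rw [pow_mul, neg_one_sq, one_pow]
    -- In degree 1 the cycle condition couples the two components, and `h` decouples them. In higher
    -- odd degrees the differential is already diagonal.
    cases m with
    | zero =>
      refine (reflectionChainsD_unit_eq_zero_iff A x).trans ⟨fun hx => ?_, fun hx => by simp [hx]⟩
      have h0 := h _ _ hx
      rw [h0, sub_self, zero_add, sub_eq_zero] at hx
      intro i
      cases i
      · exact h0
      · exact hx
    | succ m =>
      refine (reflectionChainsD_id_eq_iff A 1 x 0).trans (forall_congr' fun i => ?_)
      rw [one_smul]
      exact sub_eq_zero
  refine nonempty_groupHomology_addEquiv A (2 * m)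
    ((ψ ∘ₗ lcoeFun (α := Bool) (M := A)) ∘ₗ Submodule.subtype _) (fun t => ?_) fun ⟨x, hx⟩ => ?_
  · obtain ⟨x, hx, rfl⟩ := hψ t
    exact ⟨⟨(equivFunOnFinite.symm x : Bool →₀ A), (hcyc _).2 hx⟩, rfl⟩
  · refine (hker _ ((hcyc x).1 hx)).trans ?_
    have hε : (-1 : k) ^ (2 * m + 1) = -1 := Odd.neg_one_pow ⟨m, rfl⟩
    rw [hε]
    constructor
    · intro hy
      choose y hy using hy
      refine ⟨(equivFunOnFinite.symm y : Bool →₀ A), (reflectionChainsD_id_eq_iff A _ _ x).2 ?_⟩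
      intro i
      rw [neg_one_smul, sub_neg_eq_add]
      exact hy i
    · rintro ⟨y, hy⟩ i
      refine ⟨DFunLike.coe (F := Bool →₀ A) y i, ?_⟩
      have := (reflectionChainsD_id_eq_iff A _ y x).1 hy i
      rwa [neg_one_smul, sub_neg_eq_add] at this

end

end

/-! ### Cosets of nℤ ⋊ ℤ/2 as residues modulo n -/

section CosetCoord

/-- The integer `0` or `1` such that the reflection `i` is `z ↦ reflectionCenter i - z`. -/
def reflectionCenter (i : Bool) : ℤ := if i then 1 else 0

theorem dvd_toAdd_negAction_iff (d : ℤ) (r : Multiplicative (ZMod 2)) (x : Multiplicative ℤ) :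
    d ∣ Multiplicative.toAdd (negAction r x) ↔ d ∣ Multiplicative.toAdd x := by
  rcases multiplicative_zmod_two_eq r with rfl | rfl
  · simp
  · simp [negAction_one]

/-- The translation part of g⁻¹h is, up to sign, the difference of those of h and g, and
divisibility ignores the sign. -/
theorem inv_mul_mem_dihedralSubgroup_iff (n : ℕ) (g h : InfDihedral) :
    g⁻¹ * h ∈ dihedralSubgroup n ↔
      ((Multiplicative.toAdd g.left : ℤ) : ZMod n) = (Multiplicative.toAdd h.left : ℤ) := by
  have h1 : (g⁻¹ * h).left = negAction g.right⁻¹ (g.left⁻¹ * h.left) := by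
    simp [SemidirectProduct.mul_left, SemidirectProduct.inv_left]
  change (n : ℤ) ∣ Multiplicative.toAdd (g⁻¹ * h).left ↔ _
  rw [h1, dvd_toAdd_negAction_iff, ZMod.intCast_eq_intCast_iff_dvd_sub, toAdd_mul, toAdd_inv,
    neg_add_eq_sub]

/-- The bijection between the cosets of `nℤ ⋊ ℤ/2` and `ℤ/n`. -/
def cosetCoord (n : ℕ) : InfDihedral ⧸ dihedralSubgroup n → ZMod n :=
  Quotient.lift (fun g => ((Multiplicative.toAdd g.left : ℤ) : ZMod n)) fun g h hgh =>
    (inv_mul_mem_dihedralSubgroup_iff n g h).1 (QuotientGroup.leftRel_apply.1 hgh)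

theorem cosetCoord_mk (n : ℕ) (g : InfDihedral) :
    cosetCoord n (g : InfDihedral ⧸ dihedralSubgroup n) = (Multiplicative.toAdd g.left : ℤ) := rfl

theorem cosetCoord_injective (n : ℕ) : Function.Injective (cosetCoord n) := by
  intro a b
  induction a using QuotientGroup.induction_on
  induction b using QuotientGroup.induction_on
  intro h
  exact QuotientGroup.eq.2 ((inv_mul_mem_dihedralSubgroup_iff n _ _).2 h)

theorem cosetCoord_translation_smul (n : ℕ) (m : ℤ) (q : InfDihedral ⧸ dihedralSubgroup n) :
    cosetCoord n (dihedralTranslation m • q) = m + cosetCoord n q := by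
  induction q using QuotientGroup.induction_on with
  | H g =>
    change ((Multiplicative.toAdd (dihedralTranslation m * g).left : ℤ) : ZMod n) = _
    rw [cosetCoord_mk, SemidirectProduct.mul_left]
    simp [dihedralTranslation]

theorem cosetCoord_reflection_smul (n : ℕ) (i : Bool) (q : InfDihedral ⧸ dihedralSubgroup n) :
    cosetCoord n (dihedralReflection i • q) = reflectionCenter i - cosetCoord n q := by
  induction q using QuotientGroup.induction_on with
  | H g =>
    change ((Multiplicative.toAdd (dihedralReflection i * g).left : ℤ) : ZMod n) = _
    rw [cosetCoord_mk, SemidirectProduct.mul_left]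
    simp [dihedralReflection, negAction_one, reflectionCenter, sub_eq_add_neg]

end CosetCoord

/-! ### Coordinates, compactness and continuous functions on the odometer -/

section Coord

variable {n : ℕ → ℕ} {hdvd : ∀ i, n i ∣ n (i + 1)}

/-- The `j`-th coordinate of a point of the odometer, as an element of `ℤ/n_j`. -/
def odometerCoord (j : ℕ) (x : DihedralOdometer n hdvd) : ZMod (n j) := cosetCoord (n j) (x.coord j)

theorem odometer_ext {x y : DihedralOdometer n hdvd}
    (h : ∀ j, odometerCoord j x = odometerCoord j y) : x = y :=
  Odometer.ext (funext fun j => cosetCoord_injective _ (h j))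

theorem castHom_odometerCoord (j : ℕ) (x : DihedralOdometer n hdvd) :
    ZMod.castHom (hdvd j) (ZMod (n j)) (odometerCoord (j + 1) x) = odometerCoord j x := by
  rw [odometerCoord, odometerCoord, ← x.compat j]
  induction x.coord (j + 1) using QuotientGroup.induction_on
  change _ = ((_ : ℤ) : ZMod (n j))
  rw [cosetCoord_mk, map_intCast]
  rfl

theorem odometerCoord_eq_intCast_of_le {i j : ℕ} (hij : i ≤ j) {x : DihedralOdometer n hdvd} {m : ℤ}
    (h : odometerCoord j x = m) : odometerCoord i x = m := by
  induction j, hij using Nat.le_induction with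
  | base => exact h
  | succ j _ ih =>
    apply ih
    rw [← castHom_odometerCoord, h, map_intCast]

theorem odometerCoord_eq_of_le {i j : ℕ} (hij : i ≤ j) {x y : DihedralOdometer n hdvd}
    (h : odometerCoord j x = odometerCoord j y) : odometerCoord i x = odometerCoord i y := by
  obtain ⟨m, hm⟩ := ZMod.intCast_surjective (odometerCoord j y)
  rw [odometerCoord_eq_intCast_of_le hij (h.trans hm.symm),
    odometerCoord_eq_intCast_of_le hij hm.symm]

theorem odometerCoord_translation_smul (j : ℕ) (m : ℤ) (x : DihedralOdometer n hdvd) :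
    odometerCoord j (dihedralTranslation m • x) = m + odometerCoord j x :=
  cosetCoord_translation_smul _ _ _

theorem odometerCoord_reflection_smul (j : ℕ) (i : Bool) (x : DihedralOdometer n hdvd) :
    odometerCoord j (dihedralReflection i • x) = reflectionCenter i - odometerCoord j x :=
  cosetCoord_reflection_smul _ _ _

theorem exists_odometerCoord_eq (hdvd : ∀ i, n i ∣ n (i + 1)) {m : ℕ → ℤ}
    (hm : ∀ j, (n j : ℤ) ∣ m (j + 1) - m j) :
    ∃ x : DihedralOdometer n hdvd, ∀ j, odometerCoord j x = m j := by
  refine ⟨⟨fun j => (dihedralTranslation (m j) : InfDihedral ⧸ dihedralSubgroup (n j)),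
    fun j => cosetCoord_injective _ ?_⟩, fun j => rfl⟩
  change ((m (j + 1) : ℤ) : ZMod (n j)) = (m j : ℤ)
  exact ((ZMod.intCast_eq_intCast_iff_dvd_sub _ _ _).2 (hm j)).symm

theorem isLocallyConstant_odometerCoord (j : ℕ) :
    IsLocallyConstant (odometerCoord (n := n) (hdvd := hdvd) j) := by
  let _ : ∀ i, TopologicalSpace (InfDihedral ⧸ dihedralSubgroup (n i)) := fun _ => ⊥
  have _ : ∀ i, DiscreteTopology (InfDihedral ⧸ dihedralSubgroup (n i)) := fun _ => ⟨rfl⟩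
  have hc : Continuous fun x : DihedralOdometer n hdvd => x.coord j :=
    (continuous_apply j).comp continuous_induced_dom
  intro s
  exact (isOpen_discrete (cosetCoord (n j) ⁻¹' s)).preimage hc

theorem compactSpace_odometer (hn : ∀ i, n i ≠ 0) : CompactSpace (DihedralOdometer n hdvd) := by
  let _ : ∀ i, TopologicalSpace (InfDihedral ⧸ dihedralSubgroup (n i)) := fun _ => ⊥
  have _ : ∀ i, DiscreteTopology (InfDihedral ⧸ dihedralSubgroup (n i)) := fun _ => ⟨rfl⟩
  have _ : ∀ i, NeZero (n i) := fun i => ⟨hn i⟩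
  have _ : ∀ i, Finite (InfDihedral ⧸ dihedralSubgroup (n i)) := fun i =>
    Finite.of_injective _ (cosetCoord_injective (n i))
  have hind : Topology.IsInducing (Odometer.coord (H := fun i => dihedralSubgroup (n i))
    (hH := fun i => dihedralSubgroup_le (hdvd i))) := ⟨rfl⟩
  refine ⟨hind.isCompact_iff.2 (IsClosed.isCompact ?_)⟩
  have : Odometer.coord (H := fun i => dihedralSubgroup (n i))
      (hH := fun i => dihedralSubgroup_le (hdvd i)) '' Set.univ =
      ⋂ i, {c | Subgroup.quotientMapOfLE (dihedralSubgroup_le (hdvd i)) (c (i + 1)) = c i} := by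
    ext c
    simp only [Set.image_univ, Set.mem_range, Set.mem_iInter]
    exact ⟨fun ⟨x, hx⟩ i => hx ▸ x.compat i, fun h => ⟨⟨c, h⟩, rfl⟩⟩
  rw [this]
  exact isClosed_iInter fun i => isClosed_eq
    (continuous_of_discreteTopology.comp (continuous_apply _)) (continuous_apply _)

/-- Two continuous maps to the odometer that differ at all points of a compact set differ in a
single coordinate at all points of this set. -/
theorem exists_odometerCoord_ne {Y : Type*} [TopologicalSpace Y] {K : Set Y} (hK : IsCompact K)
    {p q : Y → DihedralOdometer n hdvd} (hp : Continuous p) (hq : Continuous q)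
    (h : ∀ y ∈ K, p y ≠ q y) : ∃ j, ∀ y ∈ K, odometerCoord j (p y) ≠ odometerCoord j (q y) := by
  have hopen (j : ℕ) : IsOpen {y | odometerCoord j (p y) ≠ odometerCoord j (q y)} :=
    (((isLocallyConstant_odometerCoord j).comp_continuous hp).prodMk
      ((isLocallyConstant_odometerCoord j).comp_continuous hq)) {z | z.1 ≠ z.2}
  -- Distinct points differ in some coordinate, and then in all later ones. So the open sets cover
  -- `K` and increase with j, and a single one suffices by compactness.
  obtain ⟨j, hj⟩ := hK.elim_directed_cover _ hopen
    (fun y hy => Set.mem_iUnion.2 (by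
      by_contra! hc
      exact h y hy (odometer_ext fun j => by simpa using hc j)))
    (directed_of_isDirected_le fun i j hij y hy hc => hy (odometerCoord_eq_of_le hij hc))
  exact ⟨j, fun y hy => hj hy⟩

/-- A continuous function on the odometer depends on a single coordinate. -/
theorem exists_odometerCoord_factor (hn : ∀ i, n i ≠ 0) (f : C(DihedralOdometer n hdvd, ℤ)) :
    ∃ j, ∀ x y, odometerCoord j x = odometerCoord j y → f x = f y := by
  have := compactSpace_odometer (hdvd := hdvd) hn
  -- On this compact set of pairs the two projections never agree, hence they differ in one common
  -- coordinate j.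
  have hK : IsClosed {z : DihedralOdometer n hdvd × DihedralOdometer n hdvd | f z.1 ≠ f z.2} :=
    (isClosed_discrete {z : ℤ × ℤ | z.1 ≠ z.2}).preimage
      (f := fun z : DihedralOdometer n hdvd × DihedralOdometer n hdvd => (f z.1, f z.2))
      (by fun_prop)
  obtain ⟨j, hj⟩ := exists_odometerCoord_ne hK.isCompact continuous_fst continuous_snd
    fun z hz h => hz (congrArg f h)
  exact ⟨j, fun x y h => by_contra fun hc => hj (x, y) hc h⟩

end Coord

/-! ### Positive-degree homology in terms of fixed points -/

section Representation

variable {n : ℕ → ℕ} {hdvd : ∀ i, n i ∣ n (i + 1)}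

local notation "ρ" => continuousIntRepresentation InfDihedral (DihedralOdometer n hdvd)

theorem continuousIntRepresentation_reflection_apply (i : Bool) (f : C(DihedralOdometer n hdvd, ℤ))
    (x : DihedralOdometer n hdvd) :
    ρ (dihedralReflection i) f x = f (dihedralReflection i • x) := by
  change f ((dihedralReflection i)⁻¹ • x) = _
  rw [dihedralReflection_inv]

theorem reflection_smul_reflection_smul (i : Bool) (x : DihedralOdometer n hdvd) :
    dihedralReflection i • dihedralReflection i • x = x := by
  rw [← mul_smul, dihedralReflection_mul_self, one_smul]

/-- Write f = f⁺ - f⁻. The reflection exchanges f⁺ and f⁻, so g = -f⁺ works. -/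
theorem exists_reflection_sub_eq (i : Bool) (f : C(DihedralOdometer n hdvd, ℤ))
    (hf : ρ (dihedralReflection i) f = -f) : ∃ g, ρ (dihedralReflection i) g - g = f := by
  refine ⟨⟨fun x => -max (f x) 0, by fun_prop⟩, ContinuousMap.ext fun x => ?_⟩
  have hx := DFunLike.congr_fun hf x
  rw [continuousIntRepresentation_reflection_apply, ContinuousMap.neg_apply] at hx
  rw [ContinuousMap.sub_apply, continuousIntRepresentation_reflection_apply]
  simp only [ContinuousMap.coe_mk, hx]
  omega

theorem translation_smul_invariant {f : C(DihedralOdometer n hdvd, ℤ)}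
    (hf : ∀ x, f (dihedralTranslation 1 • x) = f x) (m : ℕ) (x : DihedralOdometer n hdvd) :
    f (dihedralTranslation m • x) = f x := by
  induction m with
  | zero => exact congrArg f (one_smul _ x)
  | succ m ih =>
    rw [← ih, Nat.cast_succ, add_comm, ← dihedralTranslation_mul, mul_smul, hf]

/-- The action of the translations is minimal: an invariant continuous function is constant. -/
theorem eq_of_translation_invariant (hn : ∀ i, n i ≠ 0) {f : C(DihedralOdometer n hdvd, ℤ)}
    (hf : ∀ x, f (dihedralTranslation 1 • x) = f x) (x y : DihedralOdometer n hdvd) :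
    f x = f y := by
  obtain ⟨j, hj⟩ := exists_odometerCoord_factor hn f
  have : NeZero (n j) := ⟨hn j⟩
  -- Translates of x reach every residue modulo n_j, in particular that of y.
  obtain ⟨m, hm⟩ := ZMod.natCast_zmod_surjective (odometerCoord j y - odometerCoord j x)
  rw [← translation_smul_invariant hf m x]
  apply hj
  rw [odometerCoord_translation_smul, Int.cast_natCast, hm, sub_add_cancel]

/-- The function u = sf - f is negated by both reflections, hence invariant under their product t,
hence constant by minimality. A constant integer equal to its negative is zero. This decouples the
cycles of degree 1. -/
theorem reflection_invariant_of_add_eq_zero (hn : ∀ i, n i ≠ 0)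
    (f g : C(DihedralOdometer n hdvd, ℤ))
    (h : (ρ (dihedralReflection false) f - f) + (ρ (dihedralReflection true) g - g) = 0) :
    ρ (dihedralReflection false) f = f := by
  set u := ρ (dihedralReflection false) f - f with hu
  have h0 (x) : u (dihedralReflection false • x) = -u x := by
    simp [hu, continuousIntRepresentation_reflection_apply, reflection_smul_reflection_smul]
  have h1 (x) : u (dihedralReflection true • x) = -u x := by
    rw [eq_neg_of_add_eq_zero_left h]
    simp [continuousIntRepresentation_reflection_apply, reflection_smul_reflection_smul]
  have ht (x) : u (dihedralTranslation 1 • x) = u x := by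
    rw [← dihedralReflection_true_mul_false, mul_smul, h1, h0, neg_neg]
  have hzero : u = 0 := ContinuousMap.ext fun x => by
    have h2 := h0 x
    rw [eq_of_translation_invariant hn ht _ x] at h2
    rw [ContinuousMap.zero_apply]
    omega
  exact sub_eq_zero.1 hzero

theorem subsingleton_dihedralOdometerHomology_even {k : ℕ} (hk : 1 ≤ k) :
    Subsingleton (dihedralOdometerHomology n hdvd (2 * k)) :=
  subsingleton_groupHomology_even _ hk exists_reflection_sub_eq

/-- An invariant function with even values at the fixed points of a reflection `s` is of the form
`s g + g`. -/
theorem exists_reflection_add_eq (hn : ∀ i, n i ≠ 0) (i : Bool) (f : C(DihedralOdometer n hdvd, ℤ))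
    (hf : ρ (dihedralReflection i) f = f)
    (heven : ∀ x : DihedralOdometer n hdvd, dihedralReflection i • x = x → Even (f x)) :
    ∃ g, ρ (dihedralReflection i) g + g = f := by
  have := compactSpace_odometer (hdvd := hdvd) hn
  have hK : IsClosed {x | ¬ Even (f x)} :=
    (isClosed_discrete {m : ℤ | ¬ Even m}).preimage f.continuous
  -- The points where f is odd form a compact set without fixed points, so the reflection moves the
  -- j-th coordinate of all of them, for one j.
  obtain ⟨j, hj⟩ := exists_odometerCoord_ne hK.isCompact
    (continuous_const_smul (dihedralReflection i)) continuous_id fun x hx h => hx (heven x h)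
  have : NeZero (n j) := ⟨hn j⟩
  -- Over a residue fixed by the reflection, f is even and is halved. The other residues form pairs,
  -- and g takes the whole value of f on the member with the smaller representative and 0 on the
  -- other.
  let c : ZMod (n j) → ℤ → ℤ := fun z m => if reflectionCenter i - z = z then m / 2 else
    if z.val < (reflectionCenter i - z).val then m else 0
  have hc : IsLocallyConstant fun x => c (odometerCoord j x) (f x) :=
    ((isLocallyConstant_odometerCoord j).prodMk
      (IsLocallyConstant.iff_continuous _ |>.2 f.continuous)).comp fun z => c z.1 z.2
  refine ⟨⟨_, hc.continuous⟩, ContinuousMap.ext fun x => ?_⟩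
  have hx := DFunLike.congr_fun hf x
  rw [continuousIntRepresentation_reflection_apply] at hx
  rw [ContinuousMap.add_apply, continuousIntRepresentation_reflection_apply]
  simp only [ContinuousMap.coe_mk, hx, odometerCoord_reflection_smul, c, sub_sub_cancel]
  by_cases h : reflectionCenter i - odometerCoord j x = odometerCoord j x
  · have h2 : Even (f x) := by
      by_contra hx2
      exact hj x hx2 ((odometerCoord_reflection_smul j i x).trans h)
    rw [if_pos h, if_pos h.symm]
    obtain ⟨r, hr⟩ := h2
    omega
  · rw [if_neg h, if_neg (Ne.symm h)]
    have h3 := (ZMod.val_injective (n j)).ne h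
    split_ifs <;> omega

/-- If the fixed points of the two reflections are the `p t` for `t` in a finite type `T`, then the
odd homology is `(ℤ/2)^T`. -/
theorem nonempty_dihedralOdometerHomology_odd_addEquiv (hn : ∀ i, n i ≠ 0) {k : ℕ} (hk : 1 ≤ k)
    {T : Type} [Fintype T] [DecidableEq T] (p : T → Bool × DihedralOdometer n hdvd)
    (hinj : Function.Injective p) (hfix : ∀ t, dihedralReflection (p t).1 • (p t).2 = (p t).2)
    (hall : ∀ i x, dihedralReflection i • x = x → ∃ t, p t = (i, x)) :
    Nonempty (dihedralOdometerHomology n hdvd (2 * k - 1) ≃+ (T → ZMod 2)) := by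
  let ψ : (Bool → C(DihedralOdometer n hdvd, ℤ)) →+ (T → ZMod 2) :=
    { toFun := fun f t => (f (p t).1 (p t).2 : ℤ)
      map_zero' := by ext; simp
      map_add' := fun f g => by ext; simp }
  refine nonempty_groupHomology_odd_addEquiv
    (Rep.of (continuousIntRepresentation InfDihedral (DihedralOdometer n hdvd))) hk
    (reflection_invariant_of_add_eq_zero hn) ψ.toIntLinearMap (fun v => ?_) fun f hf => ?_
  -- The finitely many pairs of distinct fixed points of a common reflection are separated by one
  -- coordinate j.
  · have hK : {z : DihedralOdometer n hdvd × DihedralOdometer n hdvd |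
        ∃ s t, (p s).1 = (p t).1 ∧ s ≠ t ∧ ((p s).2, (p t).2) = z}.Finite := by
      refine (Set.finite_range fun z : T × T => ((p z.1).2, (p z.2).2)).subset ?_
      rintro _ ⟨s, t, _, _, rfl⟩
      exact ⟨(s, t), rfl⟩
    obtain ⟨j, hj⟩ := exists_odometerCoord_ne hK.isCompact continuous_fst continuous_snd (by
      rintro _ ⟨s, t, h1, h2, rfl⟩ h3
      exact h2 (hinj (Prod.ext h1 h3)))
    -- A sum of indicators of the residues of the fixed points of `i`, weighted by lifts of `v`. It
    -- is invariant because these residues are themselves fixed by the reflection.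
    let c : Bool → ZMod (n j) → ℤ := fun i z =>
      ∑ t, if (p t).1 = i ∧ z = odometerCoord j (p t).2 then ((v t).val : ℤ) else 0
    have hc (i : Bool) : IsLocallyConstant fun x : DihedralOdometer n hdvd =>
        c i (odometerCoord j x) := (isLocallyConstant_odometerCoord j).comp (c i)
    refine ⟨fun i => ⟨_, (hc i).continuous⟩, fun i => ContinuousMap.ext fun x => ?_, ?_⟩
    · refine (continuousIntRepresentation_reflection_apply i _ x).trans ?_
      simp only [ContinuousMap.coe_mk, c]
      refine Finset.sum_congr rfl fun t _ => if_congr (and_congr_right fun ht => ?_) rfl rfl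
      have h1 := congrArg (odometerCoord j) (hfix t)
      rw [odometerCoord_reflection_smul, ht] at h1
      rw [odometerCoord_reflection_smul]
      nth_rw 1 [← h1]
      exact sub_right_inj
    · ext t
      change ((c (p t).1 (odometerCoord j (p t).2) : ℤ) : ZMod 2) = v t
      have h1 : c (p t).1 (odometerCoord j (p t).2) = (v t).val := by
        simp only [c]
        rw [Finset.sum_eq_single t, if_pos ⟨rfl, rfl⟩]
        · rintro s - hst
          refine if_neg ?_
          rintro ⟨h1, h2⟩
          exact hj ((p t).2, (p s).2) ⟨t, s, h1.symm, hst.symm, rfl⟩ h2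
        · simp
      rw [h1, Int.cast_natCast, ZMod.natCast_zmod_val]
  · constructor
    · intro h i
      refine exists_reflection_add_eq hn i _ (hf i) fun x hx => ?_
      obtain ⟨t, ht⟩ := hall i x hx
      have h1 : ((f (p t).1 (p t).2 : ℤ) : ZMod 2) = 0 := congrFun h t
      rw [ht] at h1
      exact (ZMod.intCast_eq_zero_iff_even).1 h1
    · intro h
      ext t
      obtain ⟨g, hg⟩ := h (p t).1
      change ((f (p t).1 (p t).2 : ℤ) : ZMod 2) = 0
      have h2 : f (p t).1 (p t).2 = g (p t).2 + g (p t).2 := by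
        rw [← hg]
        refine congrArg (· + g (p t).2)
          ((continuousIntRepresentation_reflection_apply _ g _).trans ?_)
        rw [hfix]
      rw [h2, ZMod.intCast_eq_zero_iff_even]
      exact ⟨_, rfl⟩

end Representation

/-! ### Fixed points of the two reflections -/

section FixedPoints

variable {n : ℕ → ℕ} {hdvd : ∀ i, n i ∣ n (i + 1)}

theorem pos_of_strictMono_dvd (hmono : StrictMono n) (hdvd : ∀ i, n i ∣ n (i + 1)) (i : ℕ) :
    n i ≠ 0 := fun h => by
  have h1 := hdvd i
  rw [h, zero_dvd_iff] at h1
  exact (hmono (Nat.lt_succ_self i)).ne (h.trans h1.symm)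

theorem dvd_of_le_of_dvd_succ (hdvd : ∀ i, n i ∣ n (i + 1)) {i j : ℕ} (h : i ≤ j) : n i ∣ n j :=
  Nat.le_induction dvd_rfl (fun k _ h => h.trans (hdvd k)) j h

theorem reflection_smul_eq_iff (i : Bool) (x : DihedralOdometer n hdvd) {m : ℕ → ℤ}
    (hm : ∀ j, odometerCoord j x = m j) :
    dihedralReflection i • x = x ↔ ∀ j, (n j : ℤ) ∣ 2 * m j - reflectionCenter i := by
  have h (j : ℕ) : odometerCoord j (dihedralReflection i • x) = odometerCoord j x ↔
      (n j : ℤ) ∣ 2 * m j - reflectionCenter i := by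
    rw [odometerCoord_reflection_smul, hm, ← Int.cast_sub, ZMod.intCast_eq_intCast_iff_dvd_sub]
    ring_nf
  exact ⟨fun hx j => (h j).1 (congrArg _ hx), fun hx => odometer_ext fun j => (h j).2 (hx j)⟩

theorem exists_int_odometerCoord (x : DihedralOdometer n hdvd) :
    ∃ m : ℕ → ℤ, ∀ j, odometerCoord j x = m j := by
  choose m hm using fun j => ZMod.intCast_surjective (odometerCoord j x)
  exact ⟨m, fun j => (hm j).symm⟩

/-- The 2-torsion of ℤ/a consists of 0 and, for even a, of a/2. The two cases are the parities of
the quotient 2b/a. -/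
theorem dvd_or_dvd_sub_half_of_dvd_two_mul {a b : ℤ} (h : a ∣ 2 * b) :
    a ∣ b ∨ ∃ c, a = 2 * c ∧ a ∣ b - c := by
  obtain ⟨q, hq⟩ := h
  rcases Int.even_or_odd' q with ⟨r, rfl | rfl⟩
  · exact .inl ⟨r, by linarith⟩
  · rcases Int.even_or_odd' a with ⟨c, rfl | rfl⟩
    · exact .inr ⟨c, rfl, r, by linarith⟩
    · ring_nf at hq
      omega

/-- If infinitely many of the quotients are even, then the only fixed point of a reflection is the
origin, fixed by `s`. -/
theorem eq_of_reflection_smul_eq_of_infinite (hn : ∀ i, n i ≠ 0)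
    (hinf : {i : ℕ | Even (n (i + 1) / n i)}.Infinite) (x₀ : DihedralOdometer n hdvd)
    (h₀ : ∀ j, odometerCoord j x₀ = 0) (i : Bool) (x : DihedralOdometer n hdvd)
    (hx : dihedralReflection i • x = x) : i = false ∧ x = x₀ := by
  obtain ⟨m, hm⟩ := exists_int_odometerCoord x
  have hd := (reflection_smul_eq_iff i x hm).1 hx
  -- Beyond any index there is an l with 2 n_l dividing n_{l+1}. For ts this is a parity
  -- contradiction, since n_{l+1} would divide the odd number 2m - 1.
  have hex (j : ℕ) : ∃ l ≥ j, ∃ c : ℕ, n (l + 1) = 2 * (n l * c) := by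
    obtain ⟨l, hl, hjl⟩ := hinf.exists_gt j
    obtain ⟨c, hc⟩ := hdvd l
    rw [Set.mem_ofPred_eq, hc, Nat.mul_div_cancel_left _ (Nat.pos_of_ne_zero (hn l))] at hl
    obtain ⟨r, rfl⟩ := hl
    exact ⟨l, hjl.le, r, by rw [hc]; ring⟩
  cases i with
  | true =>
    obtain ⟨l, -, c, hc⟩ := hex 0
    obtain ⟨q, hq⟩ := hd (l + 1)
    rw [hc] at hq
    push_cast at hq
    simp only [reflectionCenter, if_true] at hq
    rw [mul_assoc] at hq
    omega
  | false =>
    refine ⟨rfl, odometer_ext fun j => ?_⟩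
    obtain ⟨l, hl, c, hc⟩ := hex j
    obtain ⟨q, hq⟩ := hd (l + 1)
    -- Divisibility of 2m_{l+1} by 2n_l forces the l-th coordinate, and hence the j-th, to vanish.
    have h1 : m (l + 1) = n l * (c * q) := by
      rw [hc] at hq
      push_cast at hq
      simp only [reflectionCenter] at hq
      norm_num at hq
      linarith
    rw [h₀, ← Int.cast_zero]
    refine odometerCoord_eq_intCast_of_le hl ?_
    rw [odometerCoord_eq_intCast_of_le (Nat.le_succ l) (hm (l + 1)), h1]
    simp

theorem exists_odd_quotients (hn : ∀ i, n i ≠ 0) (hdvd : ∀ i, n i ∣ n (i + 1))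
    (hfin : ¬ {i : ℕ | Even (n (i + 1) / n i)}.Infinite) :
    ∃ J, ∀ i ≥ J, ∃ c, n (i + 1) = n i * (2 * c + 1) := by
  obtain ⟨J, hJ⟩ := (Set.not_infinite.1 hfin).bddAbove
  refine ⟨J + 1, fun i hi => ?_⟩
  obtain ⟨c, hc⟩ := hdvd i
  have h1 : ¬ Even c := fun h => by
    have := hJ (show i ∈ {i : ℕ | Even (n (i + 1) / n i)} by
      rwa [Set.mem_ofPred_eq, hc, Nat.mul_div_cancel_left _ (Nat.pos_of_ne_zero (hn i))])
    omega
  obtain ⟨r, rfl⟩ := Nat.not_even_iff_odd.1 h1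
  exact ⟨r, hc⟩

theorem exists_odd_mul_of_le {J : ℕ} (hJ : ∀ i ≥ J, ∃ c, n (i + 1) = n i * (2 * c + 1)) {i : ℕ}
    (hi : J ≤ i) : ∃ c, n i = n J * (2 * c + 1) := by
  induction i, hi using Nat.le_induction with
  | base => exact ⟨0, by simp⟩
  | succ i hi ih =>
    obtain ⟨c, hc⟩ := ih
    obtain ⟨d, hd⟩ := hJ i hi
    exact ⟨2 * c * d + c + d, by rw [hd, hc]; ring⟩

/-- If the quotients are odd from the index `J` on, a fixed point of a reflection is determined by
its `J`-th coordinate. -/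
theorem eq_of_reflection_smul_eq_of_odd (hn : ∀ i, n i ≠ 0) {J : ℕ}
    (hJ : ∀ i ≥ J, ∃ c, n (i + 1) = n i * (2 * c + 1)) {i : Bool} {x y : DihedralOdometer n hdvd}
    (hx : dihedralReflection i • x = x) (hy : dihedralReflection i • y = y)
    (hxy : odometerCoord J x = odometerCoord J y) : x = y := by
  obtain ⟨a, ha⟩ := exists_int_odometerCoord x
  obtain ⟨b, hb⟩ := exists_int_odometerCoord y
  have key (l : ℕ) (hl : J ≤ l) : odometerCoord l x = odometerCoord l y := by
    have h1 := (reflection_smul_eq_iff i x ha).1 hx l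
    have h2 := (reflection_smul_eq_iff i y hb).1 hy l
    have h3 : (n l : ℤ) ∣ 2 * (b l - a l) := by
      have := dvd_sub h2 h1
      ring_nf at this ⊢
      exact this
    have h4 : (n J : ℤ) ∣ b l - a l := by
      rw [← ZMod.intCast_eq_intCast_iff_dvd_sub, ← odometerCoord_eq_intCast_of_le hl (ha l),
        ← odometerCoord_eq_intCast_of_le hl (hb l), hxy]
    rw [ha, hb, ZMod.intCast_eq_intCast_iff_dvd_sub]
    -- With n_l = n_J (2c + 1) and b - a = n_J q, the divisibility `h3` says that 2c + 1 divides 2q.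
    -- An odd number is coprime to 2, so it divides q.
    obtain ⟨c, hc⟩ := exists_odd_mul_of_le hJ hl
    obtain ⟨q, hq⟩ := h4
    rw [hq, hc] at h3 ⊢
    push_cast at h3 ⊢
    rw [mul_left_comm] at h3
    have hnJ : (n J : ℤ) ≠ 0 := by exact_mod_cast hn J
    rw [mul_dvd_mul_iff_left hnJ] at h3 ⊢
    exact IsCoprime.dvd_of_dvd_mul_left ⟨1, -c, by ring⟩ h3
  refine odometer_ext fun l => ?_
  rcases le_total J l with hl | hl
  · exact key l hl
  · exact odometerCoord_eq_of_le hl hxy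

/-- If the quotients are odd from the index `J` on, there is a point with `J`-th coordinate
`⌈n_J / 2⌉` that is fixed by a reflection, namely by `s` if `n_J` is even and by `ts` otherwise. -/
theorem exists_reflection_smul_eq (hdvd : ∀ i, n i ∣ n (i + 1)) {J : ℕ}
    (hJ : ∀ i ≥ J, ∃ c, n (i + 1) = n i * (2 * c + 1)) {i : Bool} {h : ℤ}
    (hh : 2 * h - reflectionCenter i = n J) :
    ∃ x : DihedralOdometer n hdvd, odometerCoord J x = h ∧ dihedralReflection i • x = x := by
  -- The fixed point is sought as half of (center + n_l). This is an integer for l ≥ J, where n_l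
  -- has the parity of n_J; below J the value at J is reused.
  have hex (l : ℕ) : ∃ m : ℤ, 2 * m - reflectionCenter i = n (max l J) := by
    obtain ⟨c, hc⟩ := exists_odd_mul_of_le hJ (le_max_right l J)
    refine ⟨h + n J * c, ?_⟩
    rw [hc]
    push_cast
    linarith
  choose m hm using hex
  obtain ⟨x, hx⟩ := exists_odometerCoord_eq hdvd (m := m) fun l => by
    rcases lt_or_ge l J with hl | hl
    · have h1 := hm l
      have h2 := hm (l + 1)
      rw [max_eq_right hl.le] at h1
      rw [max_eq_right hl] at h2
      rw [show m (l + 1) - m l = 0 by linarith]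
      exact dvd_zero _
    · have h1 := hm l
      have h2 := hm (l + 1)
      obtain ⟨c, hc⟩ := hJ l hl
      rw [max_eq_left hl] at h1
      rw [max_eq_left (hl.trans (Nat.le_succ l)), hc] at h2
      push_cast at h2
      exact ⟨c, by linarith⟩
  refine ⟨x, ?_, (reflection_smul_eq_iff i x hx).2 fun l => ?_⟩
  · rw [hx]
    congr 1
    have := hm J
    rw [max_self] at this
    linarith
  · rw [hm]
    exact_mod_cast dvd_of_le_of_dvd_succ hdvd (le_max_left l J)

theorem dihedralOdometerHomology_odd_of_infinite (hn : ∀ i, n i ≠ 0)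
    (hinf : {i : ℕ | Even (n (i + 1) / n i)}.Infinite) {k : ℕ} (hk : 1 ≤ k) :
    Nonempty (dihedralOdometerHomology n hdvd (2 * k - 1) ≃+ ZMod 2) := by
  obtain ⟨x₀, h₀⟩ := exists_odometerCoord_eq hdvd (m := fun _ => 0) fun _ => by simp
  obtain ⟨e⟩ := nonempty_dihedralOdometerHomology_odd_addEquiv hn hk (T := Unit)
    (fun _ => (false, x₀)) (fun _ _ _ => rfl)
    (fun _ => (reflection_smul_eq_iff _ _ h₀).2 fun j => by simp [reflectionCenter])
    fun i x hx => ⟨(), by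
      obtain ⟨rfl, rfl⟩ := eq_of_reflection_smul_eq_of_infinite hn hinf x₀
        (fun j => (h₀ j).trans Int.cast_zero) i x hx
      rfl⟩
  exact ⟨e.trans (AddEquiv.piUnique _)⟩

/-- From some J on the quotients are odd, so fixed points correspond to fixed residues modulo n_J.
For even n_J these are 0 and n_J/2, both for s; for odd n_J they are 0 for s and (n_J + 1)/2 for ts.
Either way there are two. -/
theorem dihedralOdometerHomology_odd_of_not_infinite (hn : ∀ i, n i ≠ 0)
    (hfin : ¬ {i : ℕ | Even (n (i + 1) / n i)}.Infinite) {k : ℕ} (hk : 1 ≤ k) :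
    Nonempty (dihedralOdometerHomology n hdvd (2 * k - 1) ≃+ ZMod 2 × ZMod 2) := by
  obtain ⟨J, hJ⟩ := exists_odd_quotients hn hdvd hfin
  obtain ⟨x₀, h₀⟩ := exists_odometerCoord_eq hdvd (m := fun _ => 0) fun _ => by simp
  have hx₀ : dihedralReflection false • x₀ = x₀ :=
    (reflection_smul_eq_iff _ _ h₀).2 fun j => by simp [reflectionCenter]
  obtain ⟨i₁, h, hh⟩ : ∃ (i : Bool) (h : ℤ), 2 * h - reflectionCenter i = n J := by
    rcases Nat.even_or_odd' (n J) with ⟨c, hc | hc⟩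
    · exact ⟨false, c, by simp [reflectionCenter, hc]⟩
    · exact ⟨true, c + 1, by simp [reflectionCenter, hc]; ring⟩
  obtain ⟨x₁, h₁, hx₁⟩ := exists_reflection_smul_eq hdvd hJ hh
  have hne : i₁ = false → x₀ ≠ x₁ := by
    rintro rfl rfl
    rw [h₀, ZMod.intCast_eq_intCast_iff_dvd_sub] at h₁
    have hnJ := hn J
    simp only [reflectionCenter, Bool.false_eq_true, if_false, sub_zero] at hh h₁
    have := Int.le_of_dvd (by omega) h₁
    omega
  have hcoord (i : Bool) (x : DihedralOdometer n hdvd) (hx : dihedralReflection i • x = x) :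
      (i = false ∧ odometerCoord J x = odometerCoord J x₀) ∨
        (i = i₁ ∧ odometerCoord J x = odometerCoord J x₁) := by
    obtain ⟨m, hm⟩ := exists_int_odometerCoord x
    have hd := (reflection_smul_eq_iff i x hm).1 hx J
    rw [hm, h₀, h₁]
    simp only [ZMod.intCast_eq_intCast_iff_dvd_sub]
    cases i with
    | false =>
      simp only [reflectionCenter, Bool.false_eq_true, if_false, sub_zero] at hd
      rcases dvd_or_dvd_sub_half_of_dvd_two_mul hd with h2 | ⟨c, hc, h2⟩
      · exact .inl ⟨rfl, by simpa using h2⟩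
      · cases i₁
        · simp only [reflectionCenter, Bool.false_eq_true, if_false] at hh
          exact .inr ⟨rfl, by rw [show h = c by omega, ← dvd_neg, neg_sub]; exact h2⟩
        · simp only [reflectionCenter, if_true] at hh
          omega
    | true =>
      simp only [reflectionCenter, if_true] at hd
      cases i₁
      · simp only [reflectionCenter, Bool.false_eq_true, if_false, sub_zero] at hh
        rw [← hh] at hd
        have := (Dvd.intro _ rfl).trans hd
        omega
      · simp only [reflectionCenter, if_true] at hh
        refine .inr ⟨rfl, ?_⟩
        -- Here 2(h - m_J) = n_J - (2m_J - 1) is divisible by n_J. The second alternative fails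
        -- because n_J = 2h - 1 is odd.
        rcases dvd_or_dvd_sub_half_of_dvd_two_mul (a := n J) (b := h - m J) (by
          have := (dvd_refl (n J : ℤ)).sub hd
          rw [← hh] at this ⊢
          ring_nf at this ⊢
          exact this) with h2 | ⟨c, hc, h2⟩
        · exact h2
        · omega
  obtain ⟨e⟩ := nonempty_dihedralOdometerHomology_odd_addEquiv hn hk (T := Bool)
    (fun t => cond t (i₁, x₁) (false, x₀)) (by
      have h2 : ((false, x₀) : Bool × DihedralOdometer n hdvd) ≠ (i₁, x₁) := fun h =>
        hne (congrArg Prod.fst h).symm (congrArg Prod.snd h)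
      rintro (_ | _) (_ | _) h
      · rfl
      · exact absurd h h2
      · exact absurd h.symm h2
      · rfl)
    (by rintro (_ | _); exacts [hx₀, hx₁])
    fun i x hx => by
      rcases hcoord i x hx with ⟨rfl, h⟩ | ⟨rfl, h⟩
      · exact ⟨false, Prod.ext rfl (eq_of_reflection_smul_eq_of_odd hn hJ hx₀ hx h.symm)⟩
      · exact ⟨true, Prod.ext rfl (eq_of_reflection_smul_eq_of_odd hn hJ hx₁ hx h.symm)⟩
  exact ⟨e.trans { Equiv.boolArrowEquivProd (ZMod 2) with map_add' := fun _ _ => rfl }⟩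

end FixedPoints

/-! ### Degree zero: coinvariants and the invariant mean -/

section Mean

variable {n : ℕ → ℕ} {hdvd : ∀ i, n i ∣ n (i + 1)}

local notation "ρ" => continuousIntRepresentation InfDihedral (DihedralOdometer n hdvd)

/-- A function on the odometer depends only on the `j`-th coordinate. -/
def FactorsThrough (f : C(DihedralOdometer n hdvd, ℤ)) (j : ℕ) : Prop :=
  ∀ x y, odometerCoord j x = odometerCoord j y → f x = f y

theorem FactorsThrough.mono {f : C(DihedralOdometer n hdvd, ℤ)} {i j : ℕ}
    (h : FactorsThrough f i) (hij : i ≤ j) : FactorsThrough f j :=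
  fun x y hxy => h x y (odometerCoord_eq_of_le hij hxy)

/-- The point of the odometer with coordinates `m`. -/
noncomputable def odometerInt (hdvd : ∀ i, n i ∣ n (i + 1)) (m : ℤ) : DihedralOdometer n hdvd :=
  (exists_odometerCoord_eq hdvd (m := fun _ => m) fun _ => by simp).choose

theorem odometerCoord_odometerInt (j : ℕ) (m : ℤ) :
    odometerCoord j (odometerInt hdvd m) = m :=
  (exists_odometerCoord_eq hdvd (m := fun _ => m) fun _ => by simp).choose_spec j

/-- The sum of the values of a function on `ℤ/n` that corresponds to `f`. -/
noncomputable def coordSum (f : C(DihedralOdometer n hdvd, ℤ)) (j : ℕ) : ℤ :=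
  ∑ m ∈ Finset.range (n j), f (odometerInt hdvd m)

theorem sum_range_zmod {N : ℕ} [NeZero N] (F : ZMod N → ℤ) :
    ∑ m ∈ Finset.range N, F m = ∑ u, F u :=
  Finset.sum_nbij' (fun m => (m : ZMod N)) ZMod.val (by simp) (by simp [ZMod.val_lt])
    (fun m hm => ZMod.val_cast_of_lt (Finset.mem_range.1 hm)) (by simp) (by simp)

/-- Along the integers f has period n_i, so the sum over n_j terms consists of n_j/n_i equal blocks.
-/
theorem coordSum_eq_of_le (hdvd : ∀ i, n i ∣ n (i + 1)) {f : C(DihedralOdometer n hdvd, ℤ)}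
    {i j : ℕ} (h : FactorsThrough f i) (hij : i ≤ j) :
    coordSum f j * n i = coordSum f i * n j := by
  obtain ⟨c, hc⟩ := dvd_of_le_of_dvd_succ hdvd hij
  have key (c : ℕ) : ∑ m ∈ Finset.range (n i * c), f (odometerInt hdvd m) = c * coordSum f i := by
    induction c with
    | zero => simp
    | succ c ih =>
      rw [Nat.mul_succ, Finset.sum_range_add, ih, coordSum, Nat.cast_succ, add_one_mul]
      congr 1
      refine Finset.sum_congr rfl fun m _ => h _ _ ?_
      simp [odometerCoord_odometerInt]
  rw [coordSum, hc, key]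
  push_cast
  ring

/-- The mean of a function over the `j`-th coordinate. -/
noncomputable def coordMean (f : C(DihedralOdometer n hdvd, ℤ)) (j : ℕ) : ℚ := coordSum f j / n j

theorem coordMean_eq_of_le (hn : ∀ i, n i ≠ 0) {f : C(DihedralOdometer n hdvd, ℤ)}
    {i j : ℕ} (h : FactorsThrough f i) (hij : i ≤ j) : coordMean f j = coordMean f i := by
  rw [coordMean, coordMean, div_eq_div_iff (by exact_mod_cast hn j) (by exact_mod_cast hn i)]
  exact_mod_cast coordSum_eq_of_le hdvd h hij

/-- The reflection permutes the residues modulo n_j by u ↦ center - u, which preserves the sum. -/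
theorem coordMean_reflection (hn : ∀ i, n i ≠ 0) (i : Bool) {f : C(DihedralOdometer n hdvd, ℤ)}
    {j : ℕ} (h : FactorsThrough f j) :
    coordMean (ρ (dihedralReflection i) f) j = coordMean f j := by
  have : NeZero (n j) := ⟨hn j⟩
  let F : ZMod (n j) → ℤ := fun u => f (odometerInt hdvd u.val)
  have hF (x : DihedralOdometer n hdvd) : f x = F (odometerCoord j x) := h _ _ (by
    rw [odometerCoord_odometerInt, Int.cast_natCast, ZMod.natCast_zmod_val])
  rw [coordMean, coordMean, coordSum, coordSum]
  simp only [continuousIntRepresentation_reflection_apply, hF, odometerCoord_reflection_smul,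
    odometerCoord_odometerInt, Int.cast_natCast]
  rw [sum_range_zmod F, sum_range_zmod fun u : ZMod (n j) => F (reflectionCenter i - u),
    ← Equiv.sum_comp (Equiv.subLeft ((reflectionCenter i : ℤ) : ZMod (n j))) F]
  rfl

theorem FactorsThrough.add {f g : C(DihedralOdometer n hdvd, ℤ)} {j : ℕ}
    (hf : FactorsThrough f j) (hg : FactorsThrough g j) : FactorsThrough (f + g) j :=
  fun x y hxy => congrArg₂ (· + ·) (hf x y hxy) (hg x y hxy)

theorem FactorsThrough.reflection {f : C(DihedralOdometer n hdvd, ℤ)} {j : ℕ}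
    (hf : FactorsThrough f j) (i : Bool) : FactorsThrough (ρ (dihedralReflection i) f) j := by
  intro x y hxy
  rw [continuousIntRepresentation_reflection_apply, continuousIntRepresentation_reflection_apply]
  exact hf _ _ (by rw [odometerCoord_reflection_smul, odometerCoord_reflection_smul, hxy])

/-- The integral of a continuous function with respect to the invariant probability measure. -/
noncomputable def odometerMean (hn : ∀ i, n i ≠ 0) (f : C(DihedralOdometer n hdvd, ℤ)) : ℚ :=
  coordMean f (exists_odometerCoord_factor hn f).choose

/-- Any two admissible coordinates give the same mean, by comparison with their maximum, so the
choice in the definition is harmless. -/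
theorem odometerMean_eq (hn : ∀ i, n i ≠ 0) {f : C(DihedralOdometer n hdvd, ℤ)} {j : ℕ}
    (h : FactorsThrough f j) :
    odometerMean hn f = coordMean f j := by
  have h0 : FactorsThrough f _ := (exists_odometerCoord_factor hn f).choose_spec
  rw [odometerMean, ← coordMean_eq_of_le hn h0 (le_max_left _ j),
    coordMean_eq_of_le hn h (le_max_right _ j)]

theorem odometerMean_add (hn : ∀ i, n i ≠ 0) (f g : C(DihedralOdometer n hdvd, ℤ)) :
    odometerMean hn (f + g) = odometerMean hn f + odometerMean hn g := by
  obtain ⟨i, hi⟩ : ∃ i, FactorsThrough f i := exists_odometerCoord_factor hn f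
  obtain ⟨j, hj⟩ : ∃ j, FactorsThrough g j := exists_odometerCoord_factor hn g
  have hi' := hi.mono (le_max_left i j)
  have hj' := hj.mono (le_max_right i j)
  rw [odometerMean_eq hn hi', odometerMean_eq hn hj', odometerMean_eq hn (hi'.add hj')]
  simp [coordMean, coordSum, Finset.sum_add_distrib, add_div]

theorem odometerMean_representation (hn : ∀ i, n i ≠ 0) (g : InfDihedral)
    (f : C(DihedralOdometer n hdvd, ℤ)) :
    odometerMean hn (ρ g f) = odometerMean hn f := by
  -- Quantifying over all f makes the property stable under products and inverses, so only the two
  -- reflections need a computation.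
  refine dihedralReflection_induction (S := {g | ∀ f : C(DihedralOdometer n hdvd, ℤ),
    odometerMean hn (ρ g f) = odometerMean hn f}) ?_ ?_ ?_ ?_ g f
  · intro f
    rw [map_one, Module.End.one_apply]
  · intro i f
    obtain ⟨j, hj⟩ : ∃ j, FactorsThrough f j := exists_odometerCoord_factor hn f
    rw [odometerMean_eq hn hj, odometerMean_eq hn (hj.reflection i), coordMean_reflection hn i hj]
  · intro g hg h hh f
    rw [map_mul, Module.End.mul_apply, hg, hh]
  · intro g hg f
    rw [← hg, ← Module.End.mul_apply, ← map_mul, mul_inv_cancel, map_one, Module.End.one_apply]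

/-- The integral as a linear map. -/
noncomputable def odometerMeanLinearMap (hn : ∀ i, n i ≠ 0) :
    C(DihedralOdometer n hdvd, ℤ) →ₗ[ℤ] fractionSubgroup n hdvd :=
  AddMonoidHom.toIntLinearMap
    { toFun := fun f => ⟨odometerMean hn f, coordSum f _, _, rfl⟩
      map_zero' := Subtype.ext (by simpa using odometerMean_add hn (hdvd := hdvd) 0 0)
      map_add' := fun f g => Subtype.ext (odometerMean_add hn f g) }

/-- The indicator function of the points with `j`-th coordinate `u`. -/
noncomputable def coordIndicator (hdvd : ∀ i, n i ∣ n (i + 1)) (j : ℕ) (u : ZMod (n j)) :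
    C(DihedralOdometer n hdvd, ℤ) where
  toFun x := (Pi.single u 1 : ZMod (n j) → ℤ) (odometerCoord j x)
  continuous_toFun :=
    ((isLocallyConstant_odometerCoord j).comp (Pi.single u 1 : ZMod (n j) → ℤ)).continuous

theorem factorsThrough_coordIndicator (j : ℕ) (u : ZMod (n j)) :
    FactorsThrough (coordIndicator hdvd j u) j := fun _ _ h =>
  congrArg (Pi.single u 1 : ZMod (n j) → ℤ) h

theorem representation_coordIndicator (j : ℕ) (m : ℤ) :
    ρ (dihedralTranslation m) (coordIndicator hdvd j 0) = coordIndicator hdvd j m := by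
  ext x
  have h : (dihedralTranslation m)⁻¹ = dihedralTranslation (-m) := by
    rw [inv_eq_iff_mul_eq_one, dihedralTranslation_mul, add_neg_cancel]
    rfl
  change (Pi.single 0 1 : ZMod (n j) → ℤ) (odometerCoord j ((dihedralTranslation m)⁻¹ • x)) =
    (Pi.single (m : ZMod (n j)) 1 : ZMod (n j) → ℤ) (odometerCoord j x)
  rw [h, odometerCoord_translation_smul, Pi.single_apply, Pi.single_apply]
  refine if_congr ?_ rfl rfl
  rw [Int.cast_neg, neg_add_eq_zero, eq_comm]

theorem coordSum_coordIndicator (hn : ∀ i, n i ≠ 0) (j : ℕ) :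
    coordSum (coordIndicator hdvd j 0) j = 1 := by
  have : NeZero (n j) := ⟨hn j⟩
  rw [coordSum]
  simp only [coordIndicator, ContinuousMap.coe_mk, odometerCoord_odometerInt, Int.cast_natCast]
  rw [sum_range_zmod]
  simp

/-- A function of the j-th coordinate is a combination of the indicators of residues modulo n_j.
These are translates of one another, so they share one class in the coinvariants. -/
theorem mk_eq_coordSum_smul (hn : ∀ i, n i ≠ 0) {f : C(DihedralOdometer n hdvd, ℤ)} {j : ℕ}
    (h : FactorsThrough f j) :
    Representation.Coinvariants.mk ρ f =
      coordSum f j • Representation.Coinvariants.mk ρ (coordIndicator hdvd j 0) := by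
  have : NeZero (n j) := ⟨hn j⟩
  have hf : f = ∑ m ∈ Finset.range (n j),
      f (odometerInt hdvd m) • coordIndicator hdvd j ((m : ℤ) : ZMod (n j)) := by
    ext x
    rw [ContinuousMap.sum_apply, Finset.sum_eq_single (odometerCoord j x).val]
    · simp [coordIndicator]
      exact h _ _ (by simp [odometerCoord_odometerInt])
    · intro m hm hne
      have h1 : odometerCoord j x ≠ ((m : ℤ) : ZMod (n j)) := fun h2 => hne (by
        rw [h2, Int.cast_natCast, ZMod.val_cast_of_lt (Finset.mem_range.1 hm)])
      simp only [coordIndicator, ContinuousMap.smul_apply, ContinuousMap.coe_mk]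
      rw [Pi.single_eq_of_ne h1, smul_zero]
    · simp [ZMod.val_lt]
  conv_lhs => rw [hf]
  rw [map_sum, coordSum, Finset.sum_smul]
  refine Finset.sum_congr rfl fun m _ => ?_
  rw [map_smul, ← representation_coordIndicator]
  congr 1
  exact Representation.Coinvariants.mk_self_apply _ _ _

/-- The mean is invariant and descends to the coinvariants. If it vanishes on f, so does the sum of
f over residues, which is the coefficient of the class of f. The indicator of a residue modulo n_j
has mean 1/n_j, whence surjectivity. -/
theorem nonempty_coinvariants_addEquiv (hn : ∀ i, n i ≠ 0) :
    Nonempty ((ρ).Coinvariants ≃+ fractionSubgroup n hdvd) := by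
  refine ⟨AddEquiv.ofBijective (Representation.Coinvariants.lift ρ (odometerMeanLinearMap hn)
    fun g => LinearMap.ext fun f => Subtype.ext (odometerMean_representation hn g f)) ⟨?_, ?_⟩⟩
  · rw [injective_iff_map_eq_zero]
    intro x hx
    obtain ⟨f, rfl⟩ := Representation.Coinvariants.mk_surjective _ x
    obtain ⟨j, hj⟩ : ∃ j, FactorsThrough f j := exists_odometerCoord_factor hn f
    have h1 : odometerMean hn f = 0 := congrArg Subtype.val hx
    rw [odometerMean_eq hn hj, coordMean, div_eq_zero_iff, Int.cast_eq_zero,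
      Nat.cast_eq_zero, or_iff_left (hn j)] at h1
    rw [mk_eq_coordSum_smul hn hj, h1, zero_smul]
  · rintro ⟨_, m, j, rfl⟩
    refine ⟨m • Representation.Coinvariants.mk ρ (coordIndicator hdvd j 0), ?_⟩
    rw [map_zsmul]
    refine Subtype.ext ?_
    change m • odometerMean hn (coordIndicator hdvd j 0) = _
    rw [odometerMean_eq hn (factorsThrough_coordIndicator j 0), coordMean,
      coordSum_coordIndicator hn, zsmul_eq_mul, Int.cast_one, mul_one_div]

end Mean

theorem mainTheorem1 (n : ℕ → ℕ) (hmono : StrictMono n) (hdvd : ∀ i, n i ∣ n (i + 1)) :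
    Nonempty (dihedralOdometerHomology n hdvd 0 ≃+ fractionSubgroup n hdvd) ∧
    ∀ k : ℕ, 1 ≤ k →
      Subsingleton (dihedralOdometerHomology n hdvd (2 * k)) ∧
      ({i : ℕ | Even (n (i + 1) / n i)}.Infinite →
        Nonempty (dihedralOdometerHomology n hdvd (2 * k - 1) ≃+ ZMod 2)) ∧
      (¬ {i : ℕ | Even (n (i + 1) / n i)}.Infinite →
        Nonempty (dihedralOdometerHomology n hdvd (2 * k - 1) ≃+ ZMod 2 × ZMod 2)) := by
  have hn := pos_of_strictMono_dvd hmono hdvd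
  refine ⟨?_, fun k hk => ⟨subsingleton_dihedralOdometerHomology_even hk,
    fun h => dihedralOdometerHomology_odd_of_infinite hn h hk,
    fun h => dihedralOdometerHomology_odd_of_not_infinite hn h hk⟩⟩
  obtain ⟨e⟩ := nonempty_coinvariants_addEquiv (hdvd := hdvd) hn
  exact ⟨(groupHomology.H0Iso (Rep.of (continuousIntRepresentation InfDihedral
    (DihedralOdometer n hdvd)))).toLinearEquiv.toAddEquiv.trans e⟩
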